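/- An arena is a finite directed graph in which every vertex has an outgoing edge, with its vertex set partitioned into Eve's and Adam's vertices. A play is an infinite path; the player controlling the current vertex chooses the next edge, by a strategy that may depend on the whole history. Given reachability sets (colors) $F_1,\ldots,F_k$, a play is winning for Eve if for every $i$ it visits some vertex of $F_i$; Eve wins from $v_0$ if she has a strategy such that, against every strategy of Adam, the resulting play from $v_0$ is winning. The game is one-player if Adam controls no vertex. Theorem (Generalized reachability one-player games where each color appears twice). (1) The following problem is solvable in polynomial time by a deterministic Turing machine: given a one-player generalized reachability game whose reachability sets $F_1,\ldots,F_k$ all have exactly two elements (with $k\ge 0$ part of the input, and the game given explicitly, by its adjacency matrix and the characteristic vectors of the sets), and a starting vertex $v_0$, decide whether Eve wins from $v_0$. (2) In a one-player arena let $F_i=\{x_i,y_i\}$ with $x_i\neq y_i$ for $1\le i\le k$, and let $v_0$ be a vertex. Write $u\preceq v$ if there is a (possibly empty) path from $u$ to $v$. Then Eve wins from $v_0$ if and only if the following 2-CNF formula over the $2k$ variables $X_1,Y_1,\ldots,X_k,Y_k$ (where $X_i$ stands for $x_i$ and $Y_i$ for $y_i$) is satisfiable: $$\bigwedge\{(\neg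 P\vee\neg Q)\mid p\not\preceq q\text{ and }q\not\preceq p\}\ \wedge\ \bigwedge\{(\neg P\vee\neg P)\mid v_0\not\preceq p\}\ \wedge\ \bigwedge_{i}(X_i\vee Y_i),$$ where $P,Q$ range over the variables, standing for the colored vertices $p,q$. -/

import Mathlib

/-! ## Arenas, strategies and plays -/

/-- An arena on the vertex set `V`: a graph whose vertices are partitioned into those controlled by
Eve and those controlled by Adam. Plays are infinite and strategies always prescribe a legal move,
so every vertex has an outgoing edge. (Finiteness of `V` is required where arenas are used.) -/
structure Arena (V : Type*) where
  /-- the vertices controlled by Eve -/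
  eve : Set V
  /-- the vertices controlled by Adam -/
  adam : Set V
  partition : IsCompl eve adam
  edge : V → V → Prop
  exists_edge : ∀ v, ∃ w, edge v w

namespace Arena

variable {V : Type*}

/-- A strategy for the player controlling the vertices in `P`: given the history `w` (the vertices
seen before the current one, oldest first) and the current position `v ∈ P`, it prescribes a legal
move. -/
structure Strategy (A : Arena V) (P : Set V) where
  move : List V → P → V
  legal : ∀ (w : List V) (v : P), A.edge v (move w v)

theorem mem_adam_of_not_mem_eve (A : Arena V) {v : V} (h : v ∉ A.eve) : v ∈ A.adam := by
  have h2 : A.eveᶜ = A.adam := A.partition.compl_eq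
  exact h2 ▸ h

open Classical in
/-- The next vertex after the history `w` and the current position `v`, chosen by the strategy of
the player who controls `v`. -/
noncomputable def next (A : Arena V) (σ : A.Strategy A.eve) (τ : A.Strategy A.adam)
    (w : List V) (v : V) : V :=
  if h : v ∈ A.eve then σ.move w ⟨v, h⟩ else τ.move w ⟨v, A.mem_adam_of_not_mem_eve h⟩

/-- History and current position after `i` moves, from `v₀`, under the strategies `σ` and `τ`. -/
noncomputable def position (A : Arena V) (v₀ : V) (σ : A.Strategy A.eve) (τ : A.Strategy A.adam) :
    ℕ → List V × V
  | 0 => ([], v₀)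
  | i + 1 =>
    let p := position A v₀ σ τ i
    (p.1 ++ [p.2], A.next σ τ p.1 p.2)

/-- The play `π(v₀, σ, τ)`. -/
noncomputable def play (A : Arena V) (v₀ : V) (σ : A.Strategy A.eve) (τ : A.Strategy A.adam) :
    ℕ → V :=
  fun i => (A.position v₀ σ τ i).2

/-- All plays of the arena: the infinite paths of its graph. -/
def plays (A : Arena V) : Set (ℕ → V) :=
  {π | ∀ i, A.edge (π i) (π (i + 1))}

/-- The generalized reachability objective `GenReach(F₁, …, F_k)`. -/
def genReach (A : Arena V) {k : ℕ} (F : Fin k → Set V) : Set (ℕ → V) :=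
  {π ∈ A.plays | ∀ i, ∃ p, π p ∈ F i}

/-- Eve wins from `v₀` for the objective `Φ`. -/
def EveWins (A : Arena V) (Φ : Set (ℕ → V)) (v₀ : V) : Prop :=
  ∃ σ : A.Strategy A.eve, ∀ τ : A.Strategy A.adam, A.play v₀ σ τ ∈ Φ

/-- One-player arenas: Adam controls no vertex. -/
def IsOnePlayer (A : Arena V) : Prop :=
  A.adam = ∅

/-- There is a (possibly empty) path from `u` to `v`. -/
def Reachable (A : Arena V) (u v : V) : Prop :=
  Relation.ReflTransGen A.edge u v

end Arena

/-! ## Formulas in conjunctive normal form with two literals per clause -/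

/-- A literal: `(x, true)` stands for `x` and `(x, false)` for `¬ x`. -/
abbrev PropLiteral (X : Type*) := X × Bool

/-- A 2-CNF formula, as the set of its clauses `ℓ₁ ∨ ℓ₂`. -/
abbrev TwoCNF (X : Type*) := Set (PropLiteral X × PropLiteral X)

/-- Some assignment makes a literal of each clause true. -/
def TwoCNF.Satisfiable {X : Type*} (φ : TwoCNF X) : Prop :=
  ∃ a : X → Bool, ∀ c ∈ φ, a c.1.1 = c.1.2 ∨ a c.2.1 = c.2.2

/-- For `F_i = {x_i, y_i}`, the vertex that a variable stands for: `(i, false)` is the variable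
`X_i` of the vertex `x_i`, and `(i, true)` is the variable `Y_i` of the vertex `y_i`. -/
def coloredVertex {V : Type*} {k : ℕ} (x y : Fin k → V) (p : Fin k × Bool) : V :=
  if p.2 then y p.1 else x p.1

/-- The 2-CNF formula of a one-player game with reachability sets `{x_i, y_i}` and initial vertex
`v₀`, with the following clauses:
* `¬ P ∨ ¬ Q`, if neither of the colored vertices of `P` and `Q` is reachable from the other;
* `¬ P ∨ ¬ P`, if the colored vertex of `P` is not reachable from `v₀`;
* `X_i ∨ Y_i`, for every color `i`. -/
def Arena.formula {V : Type*} (A : Arena V) {k : ℕ} (x y : Fin k → V) (v₀ : V) :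
    TwoCNF (Fin k × Bool) :=
  {c | ∃ p q, ¬ A.Reachable (coloredVertex x y p) (coloredVertex x y q) ∧
      ¬ A.Reachable (coloredVertex x y q) (coloredVertex x y p) ∧ c = ((p, false), (q, false))} ∪
  {c | ∃ p, ¬ A.Reachable v₀ (coloredVertex x y p) ∧ c = ((p, false), (p, false))} ∪
  {c | ∃ i, c = (((i, false), true), ((i, true), true))}

/-! ## The decision problem and polynomial time -/

/-- An input of the problem of solving generalized reachability games: a generalized reachability
game on the vertices `0, …, n - 1`, with a starting vertex. -/
structure GenReachInput where
  /-- the number of vertices -/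
  n : ℕ
  arena : Arena (Fin n)
  /-- the number of colors -/
  k : ℕ
  /-- the reachability sets -/
  target : Fin k → Set (Fin n)
  /-- the starting vertex -/
  start : Fin n

namespace GenReachInput

/-- The question to be decided: does Eve win from the starting vertex? -/
def EveWins (I : GenReachInput) : Prop :=
  I.arena.EveWins (I.arena.genReach I.target) I.start

open Classical in
/-- The characteristic bit vector of a set of vertices, closed by the separator `none`. -/
noncomputable def encodeSet {n : ℕ} (S : Set (Fin n)) : List (Option Bool) :=
  (List.ofFn fun v => some (decide (v ∈ S))) ++ [none]

/-- The encoding of inputs as words over the three letters `0`, `1` and a separator: the set of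
vertices controlled by Eve, the starting vertex, the rows of the adjacency matrix, another
separator, and the reachability sets. -/
noncomputable def encode (I : GenReachInput) : List (Option Bool) :=
  encodeSet I.arena.eve ++ encodeSet {I.start} ++
    (List.ofFn fun u => encodeSet {v | I.arena.edge u v}).flatten ++ [none] ++
    (List.ofFn fun i => encodeSet (I.target i)).flatten

theorem encodeSet_length {n : ℕ} (S : Set (Fin n)) : (encodeSet S).length = n + 1 := by
  simp [encodeSet]

theorem encodeSet_inj {n : ℕ} {S T : Set (Fin n)} {l l' : List (Option Bool)}
    (h : encodeSet S ++ l = encodeSet T ++ l') : S = T ∧ l = l' := by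
  obtain ⟨h1, h2⟩ := List.append_inj h (by simp [encodeSet_length])
  refine ⟨?_, h2⟩
  have h3 := List.ofFn_injective (List.append_cancel_right h1)
  ext v
  simpa using congrFun h3 v

theorem flatten_encodeSet_inj {n : ℕ} : ∀ {k : ℕ} {f g : Fin k → Set (Fin n)}
    {l l' : List (Option Bool)}, (List.ofFn fun i => encodeSet (f i)).flatten ++ l =
      (List.ofFn fun i => encodeSet (g i)).flatten ++ l' → f = g ∧ l = l'
  | 0, f, g, l, l', h => ⟨Subsingleton.elim _ _, by simpa using h⟩
  | k + 1, f, g, l, l', h => by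
    simp only [List.ofFn_succ, List.flatten_cons, List.append_assoc] at h
    obtain ⟨h1, h2⟩ := encodeSet_inj h
    obtain ⟨h3, h4⟩ := flatten_encodeSet_inj h2
    refine ⟨funext fun i => ?_, h4⟩
    cases i using Fin.cases with
    | zero => exact h1
    | succ i => exact congrFun h3 i

theorem length_flatten_encodeSet {n k : ℕ} (f : Fin k → Set (Fin n)) :
    (List.ofFn fun i => encodeSet (f i)).flatten.length = k * (n + 1) := by
  simp [List.length_flatten, List.map_ofFn, Function.comp_def, encodeSet_length]

theorem idxOf_encodeSet {n : ℕ} (S : Set (Fin n)) (l : List (Option Bool)) :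
    (encodeSet S ++ l).idxOf none = n := by
  unfold encodeSet
  rw [List.append_assoc, List.idxOf_append_of_notMem (by simp [List.mem_ofFn])]
  simp

/-- Different inputs have different encodings. -/
theorem encode_injective : Function.Injective encode := by
  rintro ⟨n, A, k, F, s⟩ ⟨n', A', k', F', s'⟩ h
  simp only [encode, List.append_assoc] at h
  have hn : n = n' := by
    simpa only [idxOf_encodeSet] using congrArg (List.idxOf none) h
  subst hn
  obtain ⟨h1, h⟩ := encodeSet_inj h
  obtain ⟨h2, h⟩ := encodeSet_inj h
  obtain ⟨h3, h⟩ := flatten_encodeSet_inj h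
  have h := List.append_cancel_left h
  have hk : k = k' := by
    have := congrArg List.length h
    rw [length_flatten_encodeSet, length_flatten_encodeSet] at this
    exact Nat.eq_of_mul_eq_mul_right (Nat.succ_pos n) this
  subst hk
  have h4 : F = F' := (flatten_encodeSet_inj (l := []) (l' := []) (congrArg (· ++ []) h)).1
  have h5 : A = A' := by
    obtain ⟨e, a, p, E, t⟩ := A
    obtain ⟨e', a', p', E', t'⟩ := A'
    have h6 : E = E' := by
      funext u v
      exact congrFun (congrFun h3 u) v
    have h7 : a = a' := by rw [← p.compl_eq, ← p'.compl_eq, show e = e' from h1]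
    simp only at h1
    subst h1 h6 h7
    rfl
  rw [h4, h5, Set.singleton_injective h2]

end GenReachInput

open Classical in
/-- The decision problem "given `a : α`, does `P a` hold?", whose inputs are presented to the
machine as the words `enc a`, is solvable in polynomial time by a (deterministic, multi-stack)
Turing machine. -/
def SolvableInPolyTime {α Γ : Type} (enc : α → List Γ) (P : α → Prop) : Prop :=
  Nonempty (Turing.TM2ComputableInPolyTime enc Computability.encodeBool fun a => decide (P a))

/-! ## One-player games -/

namespace Arena

variable {V : Type*}

/-! In a one-player arena a strategy amounts to the choice of a path, so Eve wins iff some infinite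
path from `v₀` meets every target. The order of the visits does not matter: a finite set of vertices
lies on one such path exactly when its members are reachable from `v₀` and pairwise comparable under
reachability. Indeed, a finite chain in a preorder has a least element; the path goes there first
and visits the others by induction (`exists_play_of_chain`). This is a condition on pairs of
vertices, the absence of a `Conflict`. Hence Eve wins iff some conflict-free set of vertices meets
every target (`IsOnePlayer.eveWins_genReach_iff`), and for two-element targets the formula says just
that (`formula_satisfiable_iff`).

The polynomial bound comes from the implication graph of 2-satisfiability, drawn on the vertices:
choosing `t` excludes every `u` in conflict with it, and so forces the partner of `u` in each color.
A conflict-free transversal exists iff every color has an element that conflicts with nothing its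
choice forces, directly or indirectly (`exists_transversal_iff`). To check this, it suffices to
close two relations transitively, edges and `Forces`, by Warshall's algorithm, and to form Boolean
combinations of matrices.

The rest implements this on a multi-stack machine. A matrix whose cells hold nine bits is stored as
a word and addressed by unary registers. The basic operation is a rule "if these bits have these
values, set that bit", swept over all values of some registers: it runs in polynomial time
(`Rule.Legal.sweep`) and acts as an existential definition (`sweep_apply`). The procedure `solve` is
a fixed composition of sweeps and loops, proved correct in `solve_apply`. -/

theorem Reachable.exists_play (A : Arena V) {S : Set V} {u v : V} (h : A.Reachable u v)
    (hv : ∃ π ∈ A.plays, π 0 = v ∧ ∀ w ∈ S, ∃ p, π p = w) :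
    ∃ π ∈ A.plays, π 0 = u ∧ ∀ w ∈ S, ∃ p, π p = w := by
  induction h using Relation.ReflTransGen.head_induction_on with
  | refl => exact hv
  | @head a _ h _ ih =>
    obtain ⟨π, hπ, h0, hS⟩ := ih
    refine ⟨fun i => Nat.casesOn i a π, fun i => ?_, rfl, fun w hw => ?_⟩
    · cases i with
      | zero => simpa [h0] using h
      | succ i => exact hπ i
    · obtain ⟨p, hp⟩ := hS w hw
      exact ⟨p + 1, hp⟩

theorem exists_play (A : Arena V) (v : V) : ∃ π ∈ A.plays, π 0 = v := by
  choose f hf using A.exists_edge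
  exact ⟨fun i => f^[i] v, fun i => by simpa only [Function.iterate_succ_apply'] using hf _, rfl⟩

theorem play_reachable {A : Arena V} {π : ℕ → V} (h : π ∈ A.plays) {i j : ℕ} (hij : i ≤ j) :
    A.Reachable (π i) (π j) := by
  induction j, hij using Nat.le_induction with
  | base => exact Relation.ReflTransGen.refl
  | succ j _ ih => exact ih.tail (h j)

/-- A finite set of pairwise comparable vertices that are reachable from `v` is visited by a play
from `v`. -/
theorem exists_play_of_chain (A : Arena V) (S : Finset V) (v : V) (hv : ∀ u ∈ S, A.Reachable v u)
    (hS : ∀ u ∈ S, ∀ w ∈ S, A.Reachable u w ∨ A.Reachable w u) :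
    ∃ π ∈ A.plays, π 0 = v ∧ ∀ w ∈ S, ∃ p, π p = w := by
  classical
  induction hn : S.card generalizing S v with
  | zero =>
    obtain ⟨π, h1, h2⟩ := A.exists_play v
    rw [Finset.card_eq_zero] at hn
    exact ⟨π, h1, h2, by simp [hn]⟩
  | succ n ih =>
    -- A least element of the chain; reachability is only a preorder, so it need not be unique.
    have hmin : ∃ m ∈ S, ∀ u ∈ S, A.Reachable m u := by
      have hne : S.Nonempty := Finset.card_pos.1 (by omega)
      clear hn ih hv
      induction hne using Finset.Nonempty.cons_induction with
      | singleton a => exact 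
          ⟨a, by simp, fun u hu => by rw [Finset.mem_singleton.1 hu]; exact Relation.ReflTransGen.refl⟩
      | cons a s ha hs ih =>
        obtain ⟨m, hm, h⟩ := ih fun u hu w hw =>
          hS u (Finset.mem_cons_of_mem hu) w (Finset.mem_cons_of_mem hw)
        rcases hS a (by simp) m (Finset.mem_cons_of_mem hm) with h1 | h1
        · refine ⟨a, by simp, fun u hu => ?_⟩
          rcases Finset.mem_cons.1 hu with rfl | hu
          · exact Relation.ReflTransGen.refl
          · exact h1.trans (h u hu)
        · refine ⟨m, Finset.mem_cons_of_mem hm, fun u hu => ?_⟩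
          rcases Finset.mem_cons.1 hu with rfl | hu
          · exact h1
          · exact h u hu
    obtain ⟨m, hm, h⟩ := hmin
    obtain ⟨π, h1, h2, h3⟩ := ih (S.erase m) m (fun u hu => h u (Finset.mem_of_mem_erase hu))
      (fun u hu w hw => hS u (Finset.mem_of_mem_erase hu) w (Finset.mem_of_mem_erase hw))
      (by rw [Finset.card_erase_of_mem hm]; omega)
    refine Reachable.exists_play A (hv m hm) ⟨π, h1, h2, fun w hw => ?_⟩
    by_cases hwm : w = m
    · exact ⟨0, by rw [h2, hwm]⟩
    · exact h3 w (Finset.mem_erase.2 ⟨hwm, hw⟩)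

/-- In a one-player arena, Eve wins if and only if some play from the initial vertex is winning. -/
theorem IsOnePlayer.eveWins_iff {A : Arena V} (hA : A.IsOnePlayer) {Φ : Set (ℕ → V)} {v₀ : V}
    (hΦ : Φ ⊆ A.plays) : A.EveWins Φ v₀ ↔ ∃ π ∈ Φ, π 0 = v₀ := by
  classical
  have hadam : ∀ v, v ∉ A.adam := fun v => by rw [hA]; exact id
  constructor
  · rintro ⟨σ, hσ⟩
    let τ : A.Strategy A.adam := ⟨fun _ v => (hadam _ v.2).elim, fun _ v => (hadam _ v.2).elim⟩
    exact ⟨_, hσ τ, rfl⟩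
  · rintro ⟨π, hπ, rfl⟩
    choose f hf using A.exists_edge
    -- The length of the history is the current time, so `π` can be followed even where it revisits
    -- a vertex. Off `π` any legal move will do.
    refine ⟨⟨fun w v => if v = π w.length then π (w.length + 1) else f v, fun w v => ?_⟩,
      fun τ => ?_⟩
    · split_ifs with h
      · rw [h]; exact hΦ hπ _
      · exact hf _
    · set σ : A.Strategy A.eve := _
      suffices h : ∀ i, (A.position (π 0) σ τ i).1.length = i ∧ (A.position (π 0) σ τ i).2 = π i by
        have : A.play (π 0) σ τ = π := funext fun i => (h i).2
        rwa [this]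
      intro i
      induction i with
      | zero => exact ⟨rfl, rfl⟩
      | succ i ih =>
        refine ⟨by simp [position, ih.1], ?_⟩
        have he : (A.position (π 0) σ τ i).2 ∈ A.eve := by
          by_contra h
          exact hadam _ (A.mem_adam_of_not_mem_eve h)
        simp only [position, next, he, dite_true]
        simp only [σ, ih.1, ih.2, if_true]

/-- Two vertices conflict if no play from `v₀` visits both of them. -/
def Conflict (A : Arena V) (v₀ u v : V) : Prop :=
  (¬ A.Reachable u v ∧ ¬ A.Reachable v u) ∨ ¬ A.Reachable v₀ u ∨ ¬ A.Reachable v₀ v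

theorem Conflict.symm {A : Arena V} {v₀ u v : V} (h : A.Conflict v₀ u v) : A.Conflict v₀ v u := by
  unfold Conflict at *
  tauto

/-- The vertices seen by a winning play form a suitable `S`; conversely a conflict-free `S` is a
finite chain above `v₀`. -/
theorem IsOnePlayer.eveWins_genReach_iff [Finite V] {A : Arena V} (hA : A.IsOnePlayer) {k : ℕ}
    (F : Fin k → Set V) (v₀ : V) : A.EveWins (A.genReach F) v₀ ↔
      ∃ S : Set V, (∀ u ∈ S, ∀ v ∈ S, ¬ A.Conflict v₀ u v) ∧ ∀ i, ∃ v ∈ F i, v ∈ S := by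
  rw [hA.eveWins_iff fun π h => h.1]
  constructor
  · rintro ⟨π, ⟨h1, h2⟩, rfl⟩
    refine ⟨Set.range π, ?_, fun i => ?_⟩
    · rintro _ ⟨i, rfl⟩ _ ⟨j, rfl⟩
      have h3 := play_reachable h1 (Nat.zero_le i)
      have h4 := play_reachable h1 (Nat.zero_le j)
      have h5 : A.Reachable (π i) (π j) ∨ A.Reachable (π j) (π i) :=
        (le_total i j).imp (play_reachable h1) (play_reachable h1)
      unfold Conflict
      tauto
    · obtain ⟨p, hp⟩ := h2 i
      exact ⟨_, hp, p, rfl⟩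
  · rintro ⟨S, h1, h2⟩
    have hfin := S.toFinite
    obtain ⟨π, h3, h4, h5⟩ := A.exists_play_of_chain hfin.toFinset v₀
      -- Reachability from `v₀` is the absence of a conflict of `u` with itself.
      (fun u hu => by
        have := h1 u (by simpa using hu) u (by simpa using hu)
        unfold Conflict at this
        tauto)
      (fun u hu w hw => by
        have := h1 u (by simpa using hu) w (by simpa using hw)
        unfold Conflict at this
        tauto)
    refine ⟨π, ⟨h3, fun i => ?_⟩, h4⟩
    obtain ⟨v, hv, hvS⟩ := h2 i
    obtain ⟨p, rfl⟩ := h5 v (by simpa using hvS)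
    exact ⟨p, hv⟩

/-- A vertex with several colors has several variables, whose values need not agree. It is still
safe to put into `S` every vertex with at least one true variable, because the negative clauses
depend only on the vertices and cover all pairs of variables. -/
theorem formula_satisfiable_iff (A : Arena V) {k : ℕ} (x y : Fin k → V) (v₀ : V) :
    (A.formula x y v₀).Satisfiable ↔ ∃ S : Set V, (∀ u ∈ S, ∀ v ∈ S, ¬ A.Conflict v₀ u v) ∧
      ∀ i, ∃ v ∈ ({x i, y i} : Set V), v ∈ S := by
  classical
  constructor
  · rintro ⟨a, ha⟩
    refine ⟨{v | ∃ p, a p = true ∧ coloredVertex x y p = v}, ?_, fun i => ?_⟩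
    · rintro _ ⟨p, hp, rfl⟩ _ ⟨q, hq, rfl⟩ h
      have key : ∀ r, a r = true → A.Reachable v₀ (coloredVertex x y r) := by
        intro r hr
        by_contra h
        have := ha _ (Or.inl (Or.inr ⟨r, h, rfl⟩))
        simp [hr] at this
      rcases h with ⟨h, h'⟩ | h | h
      · have := ha _ (Or.inl (Or.inl ⟨p, q, h, h', rfl⟩))
        simp [hp, hq] at this
      · exact h (key p hp)
      · exact h (key q hq)
    · rcases ha _ (Or.inr ⟨i, rfl⟩) with h | h
      · exact ⟨x i, by simp, _, h, by simp [coloredVertex]⟩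
      · exact ⟨y i, by simp, _, h, by simp [coloredVertex]⟩
  · rintro ⟨S, h1, h2⟩
    refine ⟨fun p => decide (coloredVertex x y p ∈ S), ?_⟩
    rintro c ((⟨p, q, h, h', rfl⟩ | ⟨p, h, rfl⟩) | ⟨i, rfl⟩)
    · simp only [decide_eq_false_iff_not]
      by_contra! hpq
      exact h1 _ hpq.1 _ hpq.2 (Or.inl ⟨h, h'⟩)
    · simp only [decide_eq_false_iff_not, or_self]
      exact fun hp => h1 _ hp _ hp (Or.inr (Or.inl h))
    · obtain ⟨v, hv, hvS⟩ := h2 i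
      rcases hv with rfl | rfl
      · left; simpa [coloredVertex] using hvS
      · right; simpa [coloredVertex] using hvS

end Arena

/-! ## Deciding the existence of a conflict-free transversal -/

section Transversal

variable {V : Type*}

/-- If `t` is chosen, then so is `w`, because the other element of a color of `w` conflicts with
`t`. -/
def Forces {ι : Type*} (C : V → V → Prop) (F : ι → Set V) (t w : V) : Prop :=
  ∃ i u, u ∈ F i ∧ w ∈ F i ∧ u ≠ w ∧ C t u

/-- Contraposition in the implication graph. If the last step to `t` comes from a color containing
`u₁` and `t`, then `u`, which excludes `t`, forces `u₁` into `T`, and `u₁` conflicts with the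
predecessor of `t`. So the conflict with `T` moves back along the path to `v`. -/
theorem Forces.exists_conflict {ι : Type*} {C : V → V → Prop} (hC : ∀ u v, C u v → C v u)
    {F : ι → Set V} {T : Set V} (hT : ∀ t ∈ T, ∀ w, Forces C F t w → w ∈ T) {v t u : V}
    (h : Relation.ReflTransGen (Forces C F) v t) (hu : u ∈ T) (htu : C t u) : ∃ u' ∈ T, C v u' := by
  induction h generalizing u with
  | refl => exact ⟨u, hu, htu⟩
  | tail _ h ih =>
    obtain ⟨i, u₁, h1, h2, h3, h4⟩ := h
    exact ih (hT u hu u₁ ⟨i, _, h2, h1, h3.symm, hC _ _ htu⟩) h4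

/-- A form of the correctness of the algorithm for 2-satisfiability. -/
theorem exists_transversal_iff {ι : Type*} [Finite ι] {C : V → V → Prop}
    (hC : ∀ u v, C u v → C v u) {F : ι → Set V} (hF : ∀ i, (F i).ncard = 2) :
    (∃ S : Set V, (∀ u ∈ S, ∀ v ∈ S, ¬ C u v) ∧ ∀ i, ∃ v ∈ F i, v ∈ S) ↔
      ∀ i, ∃ v ∈ F i, ¬ ∃ t, Relation.ReflTransGen (Forces C F) v t ∧ C v t := by
  have other : ∀ i, ∀ v ∈ F i, ∃ w ∈ F i, v ≠ w ∧ ∀ u ∈ F i, u = v ∨ u = w := by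
    intro i v hv
    obtain ⟨a, b, hab, h⟩ := Set.ncard_eq_two.1 (hF i)
    rw [h] at hv ⊢
    rcases hv with rfl | rfl
    · exact ⟨b, by simp, hab, by simp⟩
    · exact ⟨a, by simp, hab.symm, by simp [or_comm]⟩
  constructor
  · rintro ⟨S, h1, h2⟩ i
    obtain ⟨v, hv, hvS⟩ := h2 i
    refine ⟨v, hv, ?_⟩
    rintro ⟨t, h3, h4⟩
    refine h1 v hvS t ?_ h4
    clear h4
    -- Everything forced by an element of `S` is in `S`: the color behind the step meets `S`, but
    -- not in `u`, which conflicts with `b`.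
    induction h3 with
    | refl => exact hvS
    | @tail b c _ h ih =>
      obtain ⟨j, u, hu, hc, huc, hbu⟩ := h
      obtain ⟨w, hw, hwS⟩ := h2 j
      obtain ⟨w', -, -, h5⟩ := other j u hu
      rcases h5 w hw with rfl | rfl
      · exact absurd hbu (h1 _ ih _ hwS)
      · rcases h5 c hc with rfl | rfl
        · exact absurd rfl huc
        · exact hwS
  · intro h
    have := Fintype.ofFinite ι
    -- Colors are treated one at a time. Since the partial choice `T` is closed under `Forces`, it
    -- never has to be revised.
    suffices h : ∀ s : Finset ι, ∃ T : Set V, (∀ u ∈ T, ∀ v ∈ T, ¬ C u v) ∧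
        (∀ t ∈ T, ∀ w, Forces C F t w → w ∈ T) ∧ ∀ i ∈ s, ∃ v ∈ F i, v ∈ T by
      obtain ⟨T, h1, -, h2⟩ := h Finset.univ
      exact ⟨T, h1, fun i => h2 i (Finset.mem_univ i)⟩
    classical
    intro s
    induction s using Finset.induction_on with
    | empty => exact ⟨∅, by simp, by simp, by simp⟩
    | insert i s _ ih =>
      obtain ⟨T, h1, h2, h3⟩ := ih
      by_cases hi : ∃ v ∈ F i, v ∈ T
      · refine ⟨T, h1, h2, fun j hj => ?_⟩
        rcases Finset.mem_insert.1 hj with rfl | hj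
        · exact hi
        · exact h3 j hj
      · obtain ⟨v, hv, hvb⟩ := h i
        have hcl : ∀ t ∈ {t | Relation.ReflTransGen (Forces C F) v t}, ∀ w, Forces C F t w →
            w ∈ {t | Relation.ReflTransGen (Forces C F) v t} :=
          fun t ht w htw => Relation.ReflTransGen.tail ht htw
        -- A conflict with `T` would move back to `v`; then some element of `T` forces the partner
        -- of `v`, and `T` would already meet color `i`.
        have hno : ∀ t, Relation.ReflTransGen (Forces C F) v t → ∀ u ∈ T, ¬ C t u := by
          intro t ht u hu htu
          obtain ⟨u', hu', hvu⟩ := Forces.exists_conflict hC h2 ht hu htu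
          obtain ⟨w, hw, hvw, -⟩ := other i v hv
          exact hi ⟨w, hw, h2 u' hu' w ⟨i, v, hv, hw, hvw, hC _ _ hvu⟩⟩
        refine ⟨T ∪ {t | Relation.ReflTransGen (Forces C F) v t}, ?_, ?_, fun j hj => ?_⟩
        · rintro a (ha | ha) b (hb | hb)
          · exact h1 a ha b hb
          · exact fun hab => hno b hb a ha (hC _ _ hab)
          · exact hno a ha b hb
          · intro hab
            -- The same backward argument with the closure of `v` in place of `T`: an inner conflict
            -- becomes a conflict of `v` with something it forces.
            exact hvb (Forces.exists_conflict hC hcl ha hb hab)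
        · rintro t (ht | ht) w htw
          · exact Or.inl (h2 t ht w htw)
          · exact Or.inr (hcl t ht w htw)
        · rcases Finset.mem_insert.1 hj with rfl | hj
          · exact ⟨v, hv, Or.inr Relation.ReflTransGen.refl⟩
          · obtain ⟨w, hw, hwT⟩ := h3 j hj
            exact ⟨w, hw, Or.inl hwT⟩

end Transversal

/-! ## Transitive closure -/

/-- The relation computed by the first `m` rounds of Warshall's algorithm. -/
def warshall (E : ℕ → ℕ → Prop) : ℕ → ℕ → ℕ → Prop
  | 0, i, j => E i j
  | m + 1, i, j => warshall E m i j ∨ (warshall E m i m ∧ warshall E m m j)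

/-- Paths may be joined at any vertex already processed. If both halves pass through the pivot `m`,
the detour between the two visits is dropped. -/
theorem warshall_trans {E : ℕ → ℕ → Prop} {m i k j : ℕ} (hk : k < m) (h1 : warshall E m i k)
    (h2 : warshall E m k j) : warshall E m i j := by
  induction m generalizing i k j with
  | zero => omega
  | succ m ih =>
    rcases Nat.lt_succ_iff_lt_or_eq.1 hk with hk | rfl
    · rcases h1 with h1 | ⟨h1, h1'⟩ <;> rcases h2 with h2 | ⟨h2, h2'⟩
      · exact Or.inl (ih hk h1 h2)
      · exact Or.inr ⟨ih hk h1 h2, h2'⟩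
      · exact Or.inr ⟨h1, ih hk h1' h2⟩
      · exact Or.inr ⟨h1, h2'⟩
    · exact Or.inr ⟨h1.elim id And.left, h2.elim id And.right⟩

theorem warshall_of_edge {E : ℕ → ℕ → Prop} {i j : ℕ} (h : E i j) (m : ℕ) : warshall E m i j := by
  induction m with
  | zero => exact h
  | succ m ih => exact Or.inl ih

/-- `E` contains the diagonal, which accounts for empty paths. Only its values below `n` matter, as
all pivots are below `n`. -/
theorem warshall_iff_reflTransGen {n : ℕ} {E : ℕ → ℕ → Prop} {R : Fin n → Fin n → Prop}
    (h : ∀ u v : Fin n, E u v ↔ R u v ∨ u = v) (u v : Fin n) :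
    warshall E n u v ↔ Relation.ReflTransGen R u v := by
  constructor
  · suffices h : ∀ m ≤ n, ∀ u v : Fin n, warshall E m u v → Relation.ReflTransGen R u v from
      h n le_rfl u v
    intro m hm
    induction m with
    | zero =>
      intro u v huv
      rcases (h u v).1 huv with h | rfl
      · exact .single h
      · exact .refl
    | succ m ih =>
      rintro u v (h1 | ⟨h1, h2⟩)
      · exact ih (by omega) u v h1
      · exact (ih (by omega) u ⟨m, hm⟩ h1).trans (ih (by omega) ⟨m, hm⟩ v h2)
  · intro huv
    induction huv with
    | refl => exact warshall_of_edge ((h u u).2 (Or.inr rfl)) n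
    | @tail b c _ hbc ih =>
      exact warshall_trans b.2 ih (warshall_of_edge ((h b c).2 (Or.inl hbc)) n)

/-! ## Structured programs for multi-stack machines -/

namespace Turing.TM2

variable {K : Type} {Γ : K → Type} {Λ Λ' σ : Type}

/-- Rename the labels of a statement, and replace `halt` by the statement `r`. -/
def Stmt.bind (q : Stmt Γ Λ σ) (f : Λ → Λ') (r : Stmt Γ Λ' σ) : Stmt Γ Λ' σ :=
  match q with
  | .push k g q => .push k g (q.bind f r)
  | .peek k g q => .peek k g (q.bind f r)
  | .pop k g q => .pop k g (q.bind f r)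
  | .load g q => .load g (q.bind f r)
  | .branch g q₁ q₂ => .branch g (q₁.bind f r) (q₂.bind f r)
  | .goto l => .goto (f ∘ l)
  | .halt => r

variable [DecidableEq K]

/-- The continuation `r` runs within the step in which `q` would halt, so composition costs no extra
step. -/
theorem stepAux_bind (f : Λ → Λ') (r : Stmt Γ Λ' σ) (q : Stmt Γ Λ σ) (v : σ)
    (S : ∀ k, List (Γ k)) : stepAux (q.bind f r) v S =
      match stepAux q v S with
      | ⟨some l, v', S'⟩ => ⟨some (f l), v', S'⟩
      | ⟨none, v', S'⟩ => stepAux r v' S' := by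
  induction q generalizing v S with
  | branch g q₁ q₂ ih₁ ih₂ =>
    simp only [Stmt.bind, stepAux]
    cases g v
    · exact ih₂ v S
    · exact ih₁ v S
  | goto l => rfl
  | halt => rfl
  | _ => simp only [Stmt.bind, stepAux, *]

/-- `t` steps of a machine. -/
inductive Run (m : Λ → Stmt Γ Λ σ) : ℕ → Cfg Γ Λ σ → Cfg Γ Λ σ → Prop
  | refl (c) : Run m 0 c c
  | head {t c c' c''} : step m c = some c' → Run m t c' c'' → Run m (t + 1) c c''

theorem Run.trans {m : Λ → Stmt Γ Λ σ} {t t' : ℕ} {c c' c'' : Cfg Γ Λ σ} (h : Run m t c c')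
    (h' : Run m t' c' c'') : Run m (t + t') c c'' := by
  induction h with
  | refl => simpa using h'
  | @head t _ _ _ h _ ih =>
    rw [Nat.add_right_comm]
    exact .head h (ih h')

theorem Run.iterate {m : Λ → Stmt Γ Λ σ} {t : ℕ} {c c' : Cfg Γ Λ σ} (h : Run m t c c') :
    (flip Option.bind (step m))^[t] (some c) = some c' := by
  induction h with
  | refl => rfl
  | head h _ ih =>
    rw [Function.iterate_succ_apply]
    simp only [flip, Option.bind_some, h]
    exact ih

/-- A halting run of a machine can be replayed in a machine that contains a copy of it. -/
theorem Run.embed {m : Λ → Stmt Γ Λ σ} {m' : Λ' → Stmt Γ Λ' σ} (f : Λ → Λ') {r : Stmt Γ Λ' σ}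
    {l' : Option Λ'} (hm : ∀ l, m' (f l) = (m l).bind f r)
    (hr : ∀ v S, stepAux r v S = ⟨l', v, S⟩) {t : ℕ} {l : Λ} {v v' : σ} {S S' : ∀ k, List (Γ k)}
    (h : Run m t ⟨some l, v, S⟩ ⟨none, v', S'⟩) :
    Run m' t ⟨some (f l), v, S⟩ ⟨l', v', S'⟩ := by
  generalize hc : (⟨some l, v, S⟩ : Cfg Γ Λ σ) = c at h
  generalize hd : (⟨none, v', S'⟩ : Cfg Γ Λ σ) = d at h
  induction h generalizing l v S with
  | refl => subst hc; cases hd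
  | @head t c c' c'' h h' ih =>
    subst hc
    simp only [step, Option.some.injEq] at h
    have hs := stepAux_bind f r (m l) v S
    rw [h] at hs
    obtain ⟨l₁, v₁, S₁⟩ := c'
    cases l₁ with
    | some l₁ =>
      refine .head (c' := ⟨some (f l₁), v₁, S₁⟩) ?_ (ih rfl hd)
      simp only [step, hm, hs]
    | none =>
      subst hd
      cases h' with
      | refl =>
        -- The halting step of the original is the step in which the copy passes to `l'`, so the
        -- count `t` is unchanged.
        refine .head (c' := ⟨l', v', S'⟩) ?_ (.refl _)
        simp only [step, hm, hs, hr]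
      | head h _ => simp [step] at h

end Turing.TM2

open Turing Turing.TM2

/-- A program: a machine with an entry, which is left by halting. -/
structure Machine {K : Type} (Γ : K → Type) (σ : Type) where
  Λ : Type
  [fin : Fintype Λ]
  entry : Λ
  m : Λ → Stmt Γ Λ σ

namespace Machine

variable {K : Type} [DecidableEq K] {Γ : K → Type} {σ : Type}

/-- The program `P` leads from `c` to `c'` in at most `t` steps. -/
def Runs (P : Machine Γ σ) (t : ℕ) (c c' : σ × ∀ k, List (Γ k)) : Prop :=
  ∃ t' ≤ t, Run P.m t' ⟨some P.entry, c.1, c.2⟩ ⟨none, c'.1, c'.2⟩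

theorem Runs.mono {P : Machine Γ σ} {t t' : ℕ} {c c' : σ × ∀ k, List (Γ k)} (h : P.Runs t c c')
    (ht : t ≤ t') : P.Runs t' c c' := by
  obtain ⟨s, hs, h⟩ := h
  exact ⟨s, hs.trans ht, h⟩

theorem Runs.congr {P : Machine Γ σ} {t t' : ℕ} {c c' d d' : σ × ∀ k, List (Γ k)}
    (h : P.Runs t c d) (hc : c = c') (hd : d = d') (ht : t ≤ t') : P.Runs t' c' d' :=
  hc ▸ hd ▸ h.mono ht

/-- The effect of a statement without jumps. -/
def exec (q : Stmt Γ Empty σ) (c : σ × ∀ k, List (Γ k)) : σ × ∀ k, List (Γ k) :=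
  ((stepAux q c.1 c.2).var, (stepAux q c.1 c.2).stk)

theorem stepAux_bind_elim {Λ : Type} (r : Stmt Γ Λ σ) (q : Stmt Γ Empty σ)
    (c : σ × ∀ k, List (Γ k)) :
    stepAux (q.bind Empty.elim r) c.1 c.2 = stepAux r (exec q c).1 (exec q c).2 := by
  rw [stepAux_bind]
  unfold exec
  rcases stepAux q c.1 c.2 with ⟨l | l, v, S⟩
  · rfl
  · exact l.elim

/-- A single statement. -/
def basic (q : Stmt Γ Empty σ) : Machine Γ σ where
  Λ := Unit
  entry := ()
  m _ := q.bind Empty.elim .halt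

theorem runs_basic (q : Stmt Γ Empty σ) (c : σ × ∀ k, List (Γ k)) :
    (basic q).Runs 1 c (exec q c) := by
  refine ⟨1, le_rfl, .head (c' := _) ?_ (.refl _)⟩
  simp only [step, basic, stepAux_bind_elim, stepAux]

/-- First `P`, then `Q`. -/
def seq (P Q : Machine Γ σ) : Machine Γ σ where
  Λ := P.Λ ⊕ Q.Λ
  fin := @instFintypeSum _ _ P.fin Q.fin
  entry := .inl P.entry
  m
    | .inl l => (P.m l).bind .inl (.goto fun _ => .inr Q.entry)
    | .inr l => (Q.m l).bind .inr .halt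

theorem Runs.seq {P Q : Machine Γ σ} {t t' : ℕ} {c c' c'' : σ × ∀ k, List (Γ k)}
    (h : P.Runs t c c') (h' : Q.Runs t' c' c'') : (P.seq Q).Runs (t + t') c c'' := by
  obtain ⟨s, hs, h⟩ := h
  obtain ⟨s', hs', h'⟩ := h'
  refine ⟨s + s', Nat.add_le_add hs hs', Run.trans (c' := ⟨some (.inr Q.entry), c'.1, c'.2⟩) ?_ ?_⟩
  · exact h.embed (m' := (P.seq Q).m) Sum.inl (fun l => rfl) fun v S => rfl
  · exact h'.embed (m' := (P.seq Q).m) Sum.inr (fun l => rfl) fun v S => rfl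

/-- Execute `q`, and if `test` holds then, execute `P` and repeat. -/
def whileDo (q : Stmt Γ Empty σ) (test : σ → Bool) (P : Machine Γ σ) : Machine Γ σ where
  Λ := Option P.Λ
  fin := @instFintypeOption _ P.fin
  entry := none
  m
    | none => q.bind Empty.elim (.branch test (.goto fun _ => some P.entry) .halt)
    | some l => (P.m l).bind some (.goto fun _ => none)

variable {q : Stmt Γ Empty σ} {test : σ → Bool} {P : Machine Γ σ}

theorem runs_whileDo_stop {c : σ × ∀ k, List (Γ k)} (h : test (exec q c).1 = false) :
    (whileDo q test P).Runs 1 c (exec q c) := by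
  refine ⟨1, le_rfl, .head (c' := _) ?_ (.refl _)⟩
  simp only [step, whileDo, stepAux_bind_elim, stepAux, h, cond_false]

theorem runs_whileDo_step {c c' c'' : σ × ∀ k, List (Γ k)} {t t' : ℕ}
    (h : test (exec q c).1 = true) (h' : P.Runs t (exec q c) c')
    (h'' : (whileDo q test P).Runs t' c' c'') :
    (whileDo q test P).Runs (t + 1 + t') c c'' := by
  obtain ⟨s, hs, h'⟩ := h'
  obtain ⟨s', hs', h''⟩ := h''
  refine ⟨s + 1 + s', by omega, Run.trans (c' := ⟨some none, c'.1, c'.2⟩) (.head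
    (c' := ⟨some (some P.entry), (exec q c).1, (exec q c).2⟩) ?_
    (h'.embed (m' := (whileDo q test P).m) some (fun l => rfl) fun v S => rfl)) h''⟩
  simp only [step, whileDo, stepAux_bind_elim, stepAux, h, cond_true]

/-- Here `c x` is the configuration just before the test number `x`. Each round costs one step for
the test besides its body, and the failing test costs one more. -/
theorem runs_whileDo_range (c : ℕ → σ × ∀ k, List (Γ k)) (n t : ℕ)
    (h : ∀ x < n, test (exec q (c x)).1 = true ∧ P.Runs t (exec q (c x)) (c (x + 1)))
    (h' : test (exec q (c n)).1 = false) :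
    (whileDo q test P).Runs (n * (t + 1) + 1) (c 0) (exec q (c n)) := by
  induction n generalizing c with
  | zero => simpa using runs_whileDo_stop h'
  | succ n ih =>
    have h0 := h 0 (by omega)
    refine (runs_whileDo_step h0.1 h0.2
      (ih (fun x => c (x + 1)) (fun x hx => h (x + 1) (by omega)) h')).mono (le_of_eq ?_)
    ring

/-- The variant for loops that consume a list while an accumulator is folded along it. -/
theorem runs_whileDo_list {α β : Type} (c : List α → β → σ × ∀ k, List (Γ k)) (f : β → α → β)
    (t : ℕ) (h : ∀ a l b, test (exec q (c (a :: l) b)).1 = true ∧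
      P.Runs t (exec q (c (a :: l) b)) (c l (f b a)))
    (h' : ∀ b, test (exec q (c [] b)).1 = false) (l : List α) (b : β) :
    (whileDo q test P).Runs (l.length * (t + 1) + 1) (c l b) (exec q (c [] (l.foldl f b))) := by
  induction l generalizing b with
  | nil => simpa using runs_whileDo_stop (h' b)
  | cons a l ih =>
    refine (runs_whileDo_step (h a l b).1 (h a l b).2 (ih _)).mono (le_of_eq ?_)
    simp only [List.length_cons]
    ring

end Machine

/-! ## A machine with a random access memory -/

namespace GridMachine

/-- A cell of the memory. -/
abbrev Cell := Fin 9 → Bool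

/-- The symbols on the working stacks: the cells, and a separator. -/
abbrev Sym := Option Cell

/-- The working stacks: the memory to the left and to the right of the head, an auxiliary stack,
and two stacks for each of six index registers. -/
inductive Work
  | tmp | left | right
  | up (i : Fin 6)
  | down (i : Fin 6)
  deriving DecidableEq, Fintype

/-- The stacks of the machine. -/
inductive Stack
  | inp | out
  | work (s : Work)
  deriving DecidableEq, Fintype

-- Input and output keep the alphabets of their encodings, so words are loaded and read off
-- unchanged.
@[reducible]
def Gam : Stack → Type
  | .inp => Option Bool
  | .out => Bool
  | .work _ => Sym

/-- The finite control: a flag and a buffer for a symbol. -/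
abbrev Control := Bool × Option Sym

/-- The contents of all stacks. -/
def stk (w : List (Option Bool)) (o : List Bool) (f : Work → List Sym) : ∀ k, List (Gam k)
  | .inp => w
  | .out => o
  | .work s => f s

/-- The contents of the working stacks. -/
def work (tmp left right : List Sym) (up down : Fin 6 → List Sym) : Work → List Sym
  | .tmp => tmp
  | .left => left
  | .right => right
  | .up i => up i
  | .down i => down i

section

variable (w : List (Option Bool)) (o : List Bool) (f : Work → List Sym)
  (tmp left right l : List Sym) (up down : Fin 6 → List Sym)

@[simp] theorem stk_inp : stk w o f .inp = w := rfl
@[simp] theorem stk_out : stk w o f .out = o := rfl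
@[simp] theorem stk_work (s : Work) : stk w o f (.work s) = f s := rfl

@[simp] theorem update_stk_inp (w' : List (Option Bool)) :
    Function.update (stk w o f) .inp w' = stk w' o f := by
  funext k
  cases k <;> simp [stk]

@[simp] theorem update_stk_out (o' : List Bool) :
    Function.update (stk w o f) .out o' = stk w o' f := by
  funext k
  cases k <;> simp [stk]

@[simp] theorem update_stk_work (s : Work) :
    Function.update (stk w o f) (.work s) l = stk w o (Function.update f s l) := by
  funext k
  rcases k with _ | _ | s'
  · simp [stk]
  · simp [stk]
  · by_cases h : s' = s
    · subst h; simp [stk]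
    · have h' : Stack.work s' ≠ Stack.work s := fun e => h (by injection e)
      rw [Function.update_of_ne h']
      simp [stk, Function.update_of_ne h]

@[simp] theorem work_tmp : work tmp left right up down .tmp = tmp := rfl
@[simp] theorem work_left : work tmp left right up down .left = left := rfl
@[simp] theorem work_right : work tmp left right up down .right = right := rfl
@[simp] theorem work_up (i : Fin 6) : work tmp left right up down (.up i) = up i := rfl
@[simp] theorem work_down (i : Fin 6) : work tmp left right up down (.down i) = down i := rfl

@[simp] theorem update_work_tmp :
    Function.update (work tmp left right up down) .tmp l = work l left right up down := by
  funext k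
  cases k <;> simp [work]

@[simp] theorem update_work_left :
    Function.update (work tmp left right up down) .left l = work tmp l right up down := by
  funext k
  cases k <;> simp [work]

@[simp] theorem update_work_right :
    Function.update (work tmp left right up down) .right l = work tmp left l up down := by
  funext k
  cases k <;> simp [work]

@[simp] theorem update_work_up (i : Fin 6) :
    Function.update (work tmp left right up down) (.up i) l =
      work tmp left right (Function.update up i l) down := by
  funext k
  cases k <;> simp [work, Function.update_apply]

@[simp] theorem update_work_down (i : Fin 6) :
    Function.update (work tmp left right up down) (.down i) l =
      work tmp left right up (Function.update down i l) := by
  funext k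
  cases k <;> simp [work, Function.update_apply]

end

/-- A program for this machine. -/
abbrev Prog := Machine Gam Control

/-- A statement without jumps. -/
abbrev Line := Stmt Gam Empty Control

/-- Pop a symbol into the buffer. -/
def popBuf (s : Work) (q : Line) : Line := .pop (.work s) (fun v a => (v.1, a)) q

/-- Push the buffer and clear it. -/
def pushBuf (s : Work) : Line :=
  .push (.work s) (fun v => v.2.getD none) (.load (fun v => (v.1, none)) .halt)

/-- Push a separator and clear the buffer. -/
def pushSep (s : Work) : Line :=
  .push (.work s) (fun _ => none) (.load (fun v => (v.1, none)) .halt)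

/-! ### Moving symbols between stacks -/

section

variable {a : Bool} {b : Option Sym} {w : List (Option Bool)} {o : List Bool} {f : Work → List Sym}

theorem exec_popBuf (s : Work) : Machine.exec (popBuf s .halt) ((a, b), stk w o f) =
    ((a, (f s).head?), stk w o (Function.update f s (f s).tail)) := by
  simp [Machine.exec, popBuf]

theorem exec_pushBuf (s : Work) (x : Sym) :
    Machine.exec (pushBuf s) ((a, some x), stk w o f) =
      ((a, none), stk w o (Function.update f s (x :: f s))) := by
  simp [Machine.exec, pushBuf]

theorem exec_pushSep (s : Work) : Machine.exec (pushSep s) ((a, b), stk w o f) =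
      ((a, none), stk w o (Function.update f s (none :: f s))) := by
  simp [Machine.exec, pushSep]

/-- Move all symbols from one stack to another. -/
def transfer (s s' : Work) : Prog :=
  .whileDo (popBuf s .halt) (fun v => v.2.isSome) (.basic (pushBuf s'))

theorem runs_transfer {s s' : Work} (h : s ≠ s') : (transfer s s').Runs (2 * (f s).length + 1)
    ((a, none), stk w o f) ((a, none), stk w o
      (Function.update (Function.update f s []) s' ((f s).reverse ++ f s'))) := by
  have key := Machine.runs_whileDo_list (q := popBuf s .halt)
    (test := fun v : Control => v.2.isSome) (P := .basic (pushBuf s'))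
    (fun l r => ((a, none), stk w o (Function.update (Function.update f s l) s' r)))
    (fun r x => x :: r) 1 ?_ ?_ (f s) (f s')
  · refine key.congr ?_ ?_ ?_
    · simp
    · simp only [exec_popBuf, Function.update_of_ne h, Function.update_self]
      simp only [Function.update_comm h, Function.update_idem, List.head?_nil, List.tail_nil]
      simp
    · omega
  · intro x l r
    have e : Machine.exec (popBuf s .halt)
        ((a, none), stk w o (Function.update (Function.update f s (x :: l)) s' r)) =
        ((a, some x), stk w o (Function.update (Function.update f s l) s' r)) := by
      simp only [exec_popBuf, Function.update_of_ne h, Function.update_self]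
      simp only [Function.update_comm h, Function.update_idem, List.head?_cons, List.tail_cons]
    rw [e]
    refine ⟨rfl, ?_⟩
    have := Machine.runs_basic (pushBuf s') ((a, some x),
      stk w o (Function.update (Function.update f s l) s' r))
    rw [exec_pushBuf] at this
    simpa only [Function.update_idem, Function.update_self] using this
  · intro r
    simp [exec_popBuf, Function.update_of_ne h]

/-- Move cells from one stack to another, up to the next separator. -/
def transferCells (s s' : Work) : Prog :=
  .whileDo (popBuf s .halt) (fun v => (v.2.getD none).isSome) (.basic (pushBuf s'))

/-- The separator that stops the loop has been popped and stays in the buffer as `some none`, ready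
to be pushed by the caller. -/
theorem runs_transferCells {s s' : Work} (h : s ≠ s') (l : List Cell) (r : List Sym)
    (hf : f s = l.map some ++ none :: r) : (transferCells s s').Runs (2 * l.length + 1)
    ((a, none), stk w o f) ((a, some none), stk w o
      (Function.update (Function.update f s r) s' ((l.map some).reverse ++ f s'))) := by
  have key := Machine.runs_whileDo_list (q := popBuf s .halt)
    (test := fun v : Control => (v.2.getD none).isSome) (P := .basic (pushBuf s'))
    (fun (l : List Cell) r' => ((a, none), stk w o
      (Function.update (Function.update f s (l.map some ++ none :: r)) s' r')))
    (fun r' x => some x :: r') 1 ?_ ?_ l (f s')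
  · refine key.congr ?_ ?_ ?_
    · rw [← hf]
      simp
    · simp only [exec_popBuf, Function.update_of_ne h, Function.update_self]
      simp only [Function.update_comm h, Function.update_idem]
      have : ∀ (l : List Cell) (r' : List Sym), l.foldl (fun r' x => some x :: r') r' =
          (l.map some).reverse ++ r' := by
        intro l
        induction l with
        | nil => simp
        | cons x l ih => intro r'; simp [ih]
      simp [this]
    · omega
  · intro x l r'
    have e : Machine.exec (popBuf s .halt) ((a, none), stk w o
          (Function.update (Function.update f s ((x :: l).map some ++ none :: r)) s' r')) =
        ((a, some (some x)), stk w o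
          (Function.update (Function.update f s (l.map some ++ none :: r)) s' r')) := by
      simp only [exec_popBuf, Function.update_of_ne h, Function.update_self]
      simp only [Function.update_comm h, Function.update_idem]
      simp
    rw [e]
    refine ⟨rfl, ?_⟩
    have := Machine.runs_basic (pushBuf s') ((a, some (some x)),
      stk w o (Function.update (Function.update f s (l.map some ++ none :: r)) s' r'))
    rw [exec_pushBuf] at this
    simpa only [Function.update_idem, Function.update_self] using this
  · intro r
    simp [exec_popBuf, Function.update_of_ne h]

end

/-- The contents of the memory. -/
abbrev Mem := ℕ → ℕ → Cell

/-- The values of the index registers. -/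
abbrev Env := Fin 6 → ℕ

/-- The cells `s, …, s + l - 1` of a row. -/
def cells (M : Mem) (i s l : ℕ) : List Cell :=
  (List.range' s l).map (M i)

/-- The rows `s, …, s + l - 1` of the memory, with `n` cells each. -/
def rows (M : Mem) (n s l : ℕ) : List Sym :=
  (List.range' s l).flatMap fun i => (cells M i 0 n).map some ++ [none]

theorem cells_succ (M : Mem) (i s l : ℕ) : cells M i s (l + 1) = M i s :: cells M i (s + 1) l := by
  simp [cells, List.range'_succ]

theorem cells_add (M : Mem) (i s l l' : ℕ) :
    cells M i s (l + l') = cells M i s l ++ cells M i (s + l) l' := by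
  simp only [cells, ← List.range'_append_1, List.map_append]

theorem rows_succ (M : Mem) (n s l : ℕ) :
    rows M n s (l + 1) = (cells M s 0 n).map some ++ none :: rows M n (s + 1) l := by
  simp [rows, List.range'_succ]

theorem rows_concat (M : Mem) (n s l : ℕ) :
    rows M n s (l + 1) = rows M n s l ++ (cells M (s + l) 0 n).map some ++ [none] := by
  simp [rows, List.range'_concat]

theorem rows_add (M : Mem) (n s l l' : ℕ) :
    rows M n s (l + l') = rows M n s l ++ rows M n (s + l) l' := by
  simp only [rows, ← List.range'_append_1, List.flatMap_append]

theorem cells_congr {M M' : Mem} {i s l : ℕ} (h : ∀ j, s ≤ j → j < s + l → M i j = M' i j) :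
    cells M i s l = cells M' i s l := by
  refine List.map_congr_left fun j hj => ?_
  obtain ⟨h1, h2⟩ := List.mem_range'_1.1 hj
  exact h j h1 h2

theorem rows_congr {M M' : Mem} {n s l : ℕ} (h : ∀ i j, s ≤ i → i < s + l → M i j = M' i j) :
    rows M n s l = rows M' n s l := by
  refine List.flatMap_congr fun i hi => ?_
  obtain ⟨h1, h2⟩ := List.mem_range'_1.1 hi
  rw [cells_congr fun j _ _ => h i j h1 h2]

@[simp] theorem length_cells (M : Mem) (i s l : ℕ) : (cells M i s l).length = l := by
  simp [cells]

@[simp] theorem length_rows (M : Mem) (n s l : ℕ) : (rows M n s l).length = l * (n + 1) := by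
  induction l with
  | zero => simp [rows]
  | succ l ih => rw [rows_concat]; simp [ih]; ring

/-- Replace a cell. -/
def setCell (M : Mem) (i j : ℕ) (c : Cell) : Mem :=
  fun a b => if a = i ∧ b = j then c else M a b

/-- Singles out the cell under the head: what precedes it goes, reversed, to the stack `left`, and
the cell is then on top of `right`. -/
theorem rows_split {M : Mem} {n N i j : ℕ} (hi : i < N) (hj : j < n) :
    rows M n 0 N = rows M n 0 i ++ ((cells M i 0 j).map some ++ some (M i j) ::
      ((cells M i (j + 1) (n - j - 1)).map some ++ none :: rows M n (i + 1) (N - i - 1))) := by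
  obtain ⟨a, rfl⟩ : ∃ a, N = i + (a + 1) := ⟨N - i - 1, by omega⟩
  obtain ⟨b, rfl⟩ : ∃ b, n = j + (b + 1) := ⟨n - j - 1, by omega⟩
  have h1 : i + (a + 1) - i - 1 = a := by omega
  have h2 : j + (b + 1) - j - 1 = b := by omega
  rw [rows_add, Nat.zero_add, rows_succ, cells_add, Nat.zero_add, cells_succ, h1, h2]
  simp

theorem rows_setCell {M : Mem} {n N i j : ℕ} (hi : i < N) (hj : j < n) (c : Cell) :
    rows (setCell M i j c) n 0 N = rows M n 0 i ++ ((cells M i 0 j).map some ++ some c ::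
      ((cells M i (j + 1) (n - j - 1)).map some ++ none :: rows M n (i + 1) (N - i - 1))) := by
  rw [rows_split hi hj]
  have h1 : rows (setCell M i j c) n 0 i = rows M n 0 i :=
    rows_congr fun a b _ h => if_neg (by omega)
  have h2 : rows (setCell M i j c) n (i + 1) (N - i - 1) = rows M n (i + 1) (N - i - 1) :=
    rows_congr fun a b h _ => if_neg (by omega)
  have h3 : cells (setCell M i j c) i 0 j = cells M i 0 j :=
    cells_congr fun b _ h => if_neg (by omega)
  have h4 : cells (setCell M i j c) i (j + 1) (n - j - 1) = cells M i (j + 1) (n - j - 1) :=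
    cells_congr fun b h _ => if_neg (by omega)
  rw [h1, h2, h3, h4]
  simp [setCell]

/-- The register that ranges over all rows of the memory; the others range over the columns. -/
def rowReg : Fin 6 := 3

/-- The bound on an index register, in a memory with `N` rows and `n` columns. -/
def bound (n N : ℕ) (i : Fin 6) : ℕ :=
  if i = rowReg then N else n

/-- `x` separators, to represent the number `x`. -/
def unary (x : ℕ) : List Sym :=
  List.replicate x none

theorem unary_succ (x : ℕ) : unary (x + 1) = none :: unary x := rfl

@[simp] theorem length_unary (x : ℕ) : (unary x).length = x := by simp [unary]

@[simp] theorem reverse_unary (x : ℕ) : (unary x).reverse = unary x := by simp [unary]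

/-- A register is kept together with its complement to the bound. Incrementing moves one symbol from
`down` to `up`, and the bound is reached when `down` is empty. -/
def ups (e : Env) (i : Fin 6) : List Sym := unary (e i)

def downs (n N : ℕ) (e : Env) (i : Fin 6) : List Sym := unary (bound n N i - e i)

/-- The configuration that represents the state of flag and memory. -/
def rep (n N : ℕ) (e : Env) (a : Bool) (M : Mem) : Control × ∀ k, List (Gam k) :=
  ((a, none), stk [] [] (work [] [] (rows M n 0 N) (ups e) (downs n N e)))

/-- Skip `e i` rows, moving the count to the auxiliary stack. -/
def skipRows (i : Fin 6) : Prog :=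
  .whileDo (popBuf (.up i) .halt) (fun v => v.2.isSome)
    (.seq (.basic (pushSep .tmp)) (.seq (transferCells .right .left) (.basic (pushBuf .left))))

/-- Skip `e i` cells, moving the count to the auxiliary stack. -/
def skipCells (i : Fin 6) : Prog :=
  .whileDo (popBuf (.up i) .halt) (fun v => v.2.isSome)
    (.seq (.basic (pushSep .tmp)) (.seq (.basic (popBuf .right .halt)) (.basic (pushBuf .left))))

/-! ### Moving the head to a cell and back -/

section

variable {a : Bool} {b : Option Sym} {w : List (Option Bool)} {o : List Bool}
  {left right : List Sym} {up down : Fin 6 → List Sym}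

/-- Per row: one step for the test, one to count on the auxiliary stack, `2 * n + 1` to move the
cells, and one to push the separator. -/
theorem runs_skipRows {M : Mem} {n N x : ℕ} {i : Fin 6} (hi : up i = unary x) (hx : x ≤ N) :
    (skipRows i).Runs (x * (2 * n + 4) + 1)
      ((a, none), stk w o (work [] [] (rows M n 0 N) up down))
      ((a, none), stk w o (work (unary x) (rows M n 0 x).reverse (rows M n x (N - x))
        (Function.update up i []) down)) := by
  have key := Machine.runs_whileDo_range (q := popBuf (.up i) .halt)
    (test := fun v : Control => v.2.isSome)
    (P := (.seq (.basic (pushSep .tmp)) (.seq (transferCells .right .left)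
      (.basic (pushBuf .left)))))
    (fun y => ((a, none), stk w o (work (unary y) (rows M n 0 y).reverse (rows M n y (N - y))
      (Function.update up i (unary (x - y))) down))) x (2 * n + 3) ?_ ?_
  · refine key.congr ?_ ?_ le_rfl
    · rw [Nat.sub_zero, Nat.sub_zero, ← hi, Function.update_eq_self]
      simp [unary, rows]
    · rw [exec_popBuf]
      simp [unary]
  · intro y hy
    obtain ⟨z, hz⟩ : ∃ z, x - y = z + 1 := ⟨x - y - 1, by omega⟩
    obtain ⟨z', hz'⟩ : ∃ z', N - y = z' + 1 := ⟨N - y - 1, by omega⟩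
    rw [exec_popBuf]
    refine ⟨by simp [hz, unary_succ], ?_⟩
    have h1 := Machine.runs_basic (pushSep .tmp) ((a, some none), stk w o (work (unary y)
      (rows M n 0 y).reverse (rows M n y (N - y)) (Function.update up i (unary z)) down))
    rw [exec_pushSep] at h1
    have h2 := runs_transferCells (a := a) (w := w) (o := o) (s := .right) (s' := .left)
      (f := work (unary (y + 1)) (rows M n 0 y).reverse (rows M n y (N - y))
        (Function.update up i (unary z)) down) (by decide) (cells M y 0 n)
        (rows M n (y + 1) z') (by rw [work_right, hz', rows_succ])
    have h3 := Machine.runs_basic (pushBuf .left) ((a, some none), stk w o (work (unary (y + 1))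
      (((cells M y 0 n).map some).reverse ++ (rows M n 0 y).reverse) (rows M n (y + 1) z')
      (Function.update up i (unary z)) down))
    rw [exec_pushBuf] at h3
    refine (h1.seq ((h2.congr ?_ ?_ le_rfl).seq h3)).congr ?_ ?_ ?_
    · simp [unary_succ]
    · simp
    · simp [hz, unary_succ]
    · have e1 : x - (y + 1) = z := by omega
      have e2 : N - (y + 1) = z' := by omega
      simp [rows_concat, e1, e2]
    · simp; omega
  · rw [exec_popBuf]
    simp [unary]

theorem runs_skipCells {l : List Cell} {x : ℕ} {i : Fin 6} (hi : up i = unary x)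
    (hx : l.length = x) :
    (skipCells i).Runs (x * 4 + 1)
      ((a, none), stk w o (work [] left (l.map some ++ right) up down))
      ((a, none), stk w o (work (unary x) ((l.map some).reverse ++ left) right
        (Function.update up i []) down)) := by
  have key := Machine.runs_whileDo_range (q := popBuf (.up i) .halt)
    (test := fun v : Control => v.2.isSome)
    (P := (.seq (.basic (pushSep .tmp)) (.seq (.basic (popBuf .right .halt))
      (.basic (pushBuf .left)))))
    (fun y => ((a, none), stk w o (work (unary y) (((l.take y).map some).reverse ++ left)
      ((l.drop y).map some ++ right) (Function.update up i (unary (x - y))) down))) x 3 ?_ ?_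
  · refine key.congr ?_ ?_ le_rfl
    · rw [Nat.sub_zero, ← hi, Function.update_eq_self]
      simp [unary]
    · rw [exec_popBuf]
      simp [unary, ← hx]
  · intro y hy
    obtain ⟨z, hz⟩ : ∃ z, x - y = z + 1 := ⟨x - y - 1, by omega⟩
    rw [exec_popBuf]
    refine ⟨by simp [hz, unary_succ], ?_⟩
    have hl : y < l.length := by omega
    have h1 := Machine.runs_basic (pushSep .tmp) ((a, some none), stk w o (work (unary y)
      (((l.take y).map some).reverse ++ left) ((l.drop y).map some ++ right)
      (Function.update up i (unary z)) down))
    rw [exec_pushSep] at h1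
    have h2 := Machine.runs_basic (popBuf .right .halt) ((a, none), stk w o
      (work (unary (y + 1)) (((l.take y).map some).reverse ++ left) ((l.drop y).map some ++ right)
        (Function.update up i (unary z)) down))
    rw [exec_popBuf] at h2
    have h3 := Machine.runs_basic (pushBuf .left) ((a, some (some l[y])), stk w o
      (work (unary (y + 1)) (((l.take y).map some).reverse ++ left)
        ((l.drop (y + 1)).map some ++ right) (Function.update up i (unary z)) down))
    rw [exec_pushBuf] at h3
    have hd : l.drop y = l[y] :: l.drop (y + 1) := List.drop_eq_getElem_cons hl
    refine (h1.seq ((h2.congr ?_ ?_ le_rfl).seq h3)).congr ?_ ?_ ?_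
    · simp [unary_succ]
    · rw [hd]
      simp [-List.getElem_cons_drop]
    · simp [hz, unary_succ]
    · have e1 : x - (y + 1) = z := by omega
      simp only [e1, List.take_succ_eq_append_getElem hl]
      simp [-List.take_append_getElem]
    · omega
  · rw [exec_popBuf]
    simp [unary]

/-- Move the count on the auxiliary stack back to a register. -/
theorem runs_restore {x : ℕ} {i : Fin 6} (hi : up i = unary x) :
    (transfer .tmp (.up i)).Runs (2 * x + 1)
      ((a, none), stk w o (work (unary x) left right (Function.update up i []) down))
      ((a, none), stk w o (work [] left right up down)) := by
  refine (runs_transfer (by simp)).congr rfl ?_ ?_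
  · simp
    rw [← hi, Function.update_eq_self]
  · simp

theorem runs_rewind : (transfer .left .right).Runs (2 * left.length + 1)
      ((a, none), stk w o (work [] left right up down))
      ((a, none), stk w o (work [] [] (left.reverse ++ right) up down)) := by
  refine (runs_transfer (by simp)).congr rfl ?_ le_rfl
  simp

end

/-- Apply `f` to the cell under the head and the flag. -/
def modify (f : Cell → Bool → Cell × Bool) : Line :=
  .pop (.work .right) (fun v x => ((f ((x.getD none).getD default) v.1).2,
    some (some (f ((x.getD none).getD default) v.1).1))) (pushBuf .right)

theorem exec_modify (f : Cell → Bool → Cell × Bool) {a : Bool} {w : List (Option Bool)}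
    {o : List Bool} {tmp left right : List Sym} {up down : Fin 6 → List Sym} {c : Cell} :
    Machine.exec (modify f) ((a, none), stk w o (work tmp left (some c :: right) up down)) =
      (((f c a).2, none), stk w o (work tmp left (some (f c a).1 :: right) up down)) := by
  simp [Machine.exec, modify, pushBuf]

/-- Apply `f` to the cell with the indices in the registers `i` and `j`, and the flag. -/
def access (i j : Fin 6) (f : Cell → Bool → Cell × Bool) : Prog :=
  .seq (skipRows i) <| .seq (transfer .tmp (.up i)) <| .seq (skipCells j) <|
    .seq (transfer .tmp (.up j)) <| .seq (.basic (modify f)) (transfer .left .right)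

/-- Each register is restored right after use: the auxiliary stack must be empty for the next count,
and `i` and `j` may coincide. The bound is crude; every phase is at most linear in the size of the
memory. -/
theorem runs_access (i j : Fin 6) (f : Cell → Bool → Cell × Bool) {n N : ℕ} {e : Env} {a : Bool}
    {M : Mem} (hi : e i < N) (hj : e j < n) :
    (access i j f).Runs (20 * (N + 1) * (n + 1)) (rep n N e a M)
      (rep n N e (f (M (e i) (e j)) a).2
        (setCell M (e i) (e j) (f (M (e i) (e j)) a).1)) := by
  set x := e i
  set y := e j
  have hr := rows_split (M := M) hi hj
  have h1 := runs_skipRows (a := a) (w := []) (o := []) (M := M) (n := n) (up := ups e)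
    (down := downs n N e) (i := i) (x := x) rfl hi.le
  have h2 := runs_restore (a := a) (w := []) (o := []) (left := (rows M n 0 x).reverse)
    (right := rows M n x (N - x)) (up := ups e) (down := downs n N e) (i := i) (x := x) rfl
  have h3 := runs_skipCells (a := a) (w := []) (o := []) (left := (rows M n 0 x).reverse)
    (right := some (M x y) :: ((cells M x (y + 1) (n - y - 1)).map some ++ none ::
      rows M n (x + 1) (N - x - 1))) (up := ups e) (down := downs n N e) (i := j) (x := y)
    (l := cells M x 0 y) rfl (by simp)
  have h4 := runs_restore (a := a) (w := []) (o := [])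
    (left := ((cells M x 0 y).map some).reverse ++ (rows M n 0 x).reverse)
    (right := some (M x y) :: ((cells M x (y + 1) (n - y - 1)).map some ++ none ::
      rows M n (x + 1) (N - x - 1))) (up := ups e) (down := downs n N e) (i := j) (x := y) rfl
  have h5 := Machine.runs_basic (modify f) ((a, none), stk [] [] (work []
    (((cells M x 0 y).map some).reverse ++ (rows M n 0 x).reverse)
    (some (M x y) :: ((cells M x (y + 1) (n - y - 1)).map some ++ none ::
      rows M n (x + 1) (N - x - 1))) (ups e) (downs n N e)))
  rw [exec_modify] at h5
  have h6 := runs_rewind (a := (f (M x y) a).2) (w := []) (o := [])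
    (left := ((cells M x 0 y).map some).reverse ++ (rows M n 0 x).reverse)
    (right := some (f (M x y) a).1 :: ((cells M x (y + 1) (n - y - 1)).map some ++ none ::
      rows M n (x + 1) (N - x - 1))) (up := ups e) (down := downs n N e)
  refine (h1.seq (h2.seq ((h3.congr ?_ rfl le_rfl).seq (h4.seq (h5.seq h6))))).congr rfl ?_ ?_
  · have h7 : rows M n 0 N = rows M n 0 x ++ rows M n x (N - x) := by
      have := rows_add M n 0 x (N - x)
      rwa [Nat.zero_add, Nat.add_sub_cancel' hi.le] at this
    rw [h7] at hr
    rw [List.append_cancel_left hr]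
  · rw [rep, rows_setCell hi hj]
    simp
  · simp only [List.length_append, List.length_reverse, List.length_map, length_cells, length_rows]
    have : x * (2 * n + 4) ≤ N * (2 * n + 4) := Nat.mul_le_mul_right _ hi.le
    have : x * (n + 1) ≤ N * (n + 1) := Nat.mul_le_mul_right _ hi.le
    nlinarith

/-- The transformation `f` of the memory, which depends on the size of the memory and the index
registers, is computed by a program in polynomial time, provided that the registers in `s` are `0`
initially. -/
def Realizable (s : Finset (Fin 6)) (f : ℕ → ℕ → Env → Mem → Mem) : Prop :=
  ∃ (P : Prog) (p : Polynomial ℕ), ∀ (m n N : ℕ) (e : Env) (M : Mem), n ≤ N → N ≤ m →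
    (∀ i, e i < bound n N i) → (∀ i ∈ s, e i = 0) →
      P.Runs (p.eval m) (rep n N e true M) (rep n N e true (f n N e M))

theorem Realizable.mono {s t : Finset (Fin 6)} {f : ℕ → ℕ → Env → Mem → Mem}
    (h : Realizable s f) (hst : s ⊆ t) : Realizable t f := by
  obtain ⟨P, p, h⟩ := h
  exact ⟨P, p, fun m n N e M h1 h2 h3 h4 => h m n N e M h1 h2 h3 fun i hi => h4 i (hst hi)⟩

theorem Realizable.comp {s : Finset (Fin 6)} {f g : ℕ → ℕ → Env → Mem → Mem}
    (hf : Realizable s f) (hg : Realizable s g) :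
    Realizable s fun n N e M => g n N e (f n N e M) := by
  obtain ⟨P, p, hP⟩ := hf
  obtain ⟨Q, q, hQ⟩ := hg
  refine ⟨P.seq Q, p + q, fun m n N e M h1 h2 h3 h4 => ?_⟩
  rw [Polynomial.eval_add]
  exact (hP m n N e M h1 h2 h3 h4).seq (hQ m n N e _ h1 h2 h3 h4)

/-! ### Loops over the values of an index register -/

/-- Apply `f` for all values of the register `i`. -/
def forEach (i : Fin 6) (f : ℕ → ℕ → Env → Mem → Mem) : ℕ → ℕ → Env → Mem → Mem :=
  fun n N e M => (List.range (bound n N i)).foldl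
    (fun M x => f n N (Function.update e i x) M) M

/-- Look whether the register `i` has reached its bound. -/
def peekDown (i : Fin 6) : Line :=
  .peek (.work (.down i)) (fun v a => (v.1, a)) .halt

/-- Increment the register `i`. -/
def increment (i : Fin 6) : Line :=
  popBuf (.down i) (pushBuf (.up i))

def clearBuf : Line :=
  .load (fun v => (v.1, none)) .halt

/-- The final transfer sets the register back to `0`, so loops can be composed and nested. As `i ∉
s`, the body still finds its own registers at `0` in every round. -/
theorem Realizable.forEach {s : Finset (Fin 6)} {f : ℕ → ℕ → Env → Mem → Mem}
    (hf : Realizable s f) {i : Fin 6} (hi : i ∉ s) : Realizable (insert i s) (forEach i f) := by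
  obtain ⟨P, p, hP⟩ := hf
  refine ⟨.seq (.whileDo (peekDown i) (fun v => v.2.isSome)
    (.seq (.basic clearBuf) (.seq P (.basic (increment i))))) (transfer (.up i) (.down i)),
    Polynomial.X * (p + 3) + 1 + (2 * Polynomial.X + 1), fun m n N e M h1 h2 h3 h4 => ?_⟩
  have hei : e i = 0 := h4 i (Finset.mem_insert_self i s)
  set B := bound n N i with hB
  have hBm : B ≤ m := by unfold bound at hB; split_ifs at hB <;> omega
  -- `st x` is the memory after the rounds `0, …, x - 1`, and `c x` the configuration at the next
  -- test.
  let st : ℕ → Mem := fun x => (List.range x).foldl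
    (fun M x => f n N (Function.update e i x) M) M
  let c : ℕ → Control × ∀ k, List (Gam k) := fun x => ((true, none), stk [] [] (work [] []
    (rows (st x) n 0 N) (Function.update (ups e) i (unary x))
      (Function.update (downs n N e) i (unary (B - x)))))
  have hc : ∀ x, c x = rep n N (Function.update e i x) true (st x) := by
    intro x
    have e1 : ups (Function.update e i x) = Function.update (ups e) i (unary x) := by
      funext j
      by_cases h : j = i
      · subst h; simp [ups]
      · simp [ups, h]
    have e2 : downs n N (Function.update e i x) =
        Function.update (downs n N e) i (unary (B - x)) := by
      funext j
      by_cases h : j = i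
      · subst h; simp [downs, hB]
      · simp [downs, h]
    simp only [c, rep, e1, e2]
  have hpeek : ∀ x, Machine.exec (peekDown i) (c x) = ((true, (unary (B - x)).head?), (c x).2) := by
    intro x
    simp [Machine.exec, peekDown, c]
  have key := Machine.runs_whileDo_range (q := peekDown i)
    (test := fun v : Control => v.2.isSome)
    (P := (.seq (.basic clearBuf) (.seq P (.basic (increment i))))) c B (p.eval m + 2) ?_ ?_
  · have h5 := runs_transfer (a := true) (w := []) (o := []) (s := .up i) (s' := .down i)
      (f := work [] [] (rows (st B) n 0 N) (Function.update (ups e) i (unary B))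
        (Function.update (downs n N e) i [])) (by simp)
    refine ((key.congr rfl ?_ le_rfl).seq h5).congr ?_ ?_ ?_
    · rw [hpeek]
      simp [unary, c]
    · have e0 : Function.update e i 0 = e := by rw [← hei, Function.update_eq_self]
      rw [hc, e0]
      rfl
    · have e1 : downs n N e = Function.update (downs n N e) i (unary B) := by
        rw [eq_comm, Function.update_eq_self_iff]
        simp [downs, hei, hB]
      have e2 : ups e = Function.update (ups e) i [] := by
        rw [eq_comm, Function.update_eq_self_iff]
        simp [ups, hei, unary]
      rw [rep, e1, e2]
      simp [st, GridMachine.forEach, hB]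
    · simp only [work_up, Function.update_self, length_unary, Polynomial.eval_add,
        Polynomial.eval_mul, Polynomial.eval_X, Polynomial.eval_one, Polynomial.eval_ofNat]
      have : B * (p.eval m + 3) ≤ m * (p.eval m + 3) := Nat.mul_le_mul_right _ hBm
      change B * (p.eval m + 3) + 1 + _ ≤ _
      omega
  · intro x hx
    obtain ⟨y, hy⟩ : ∃ y, B - x = y + 1 := ⟨B - x - 1, by omega⟩
    rw [hpeek]
    refine ⟨by simp [hy, unary_succ], ?_⟩
    have h5 := Machine.runs_basic clearBuf ((true, (unary (B - x)).head?), (c x).2)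
    have h6 := hP m n N (Function.update e i x) (st x) h1 h2 (fun j => ?_) (fun j hj => ?_)
    · have h7 := Machine.runs_basic (increment i) (rep n N (Function.update e i x) true
        (f n N (Function.update e i x) (st x)))
      refine (h5.seq ((h6.congr ?_ rfl le_rfl).seq h7)).congr rfl ?_ ?_
      · rw [← hc]
        rfl
      · have e1 : st (x + 1) = f n N (Function.update e i x) (st x) := by
          simp [st, List.range_succ]
        -- Between body and increment, the memory is that of round `x + 1` while the register still
        -- holds `x`.
        have e2 : rep n N (Function.update e i x) true (st (x + 1)) = ((true, none), stk [] []
            (work [] [] (rows (st (x + 1)) n 0 N) (Function.update (ups e) i (unary x))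
            (Function.update (downs n N e) i (unary (B - x))))) := by
          have := hc x
          simp only [c, rep, Prod.mk.injEq, true_and] at this ⊢
          have e3 := congrFun this
          congr 1
          funext k
          cases k with
          | right => rfl
          | up j => exact (e3 (.work (.up j))).symm
          | down j => exact (e3 (.work (.down j))).symm
          | _ => rfl
        have e3 : B - (x + 1) = y := by omega
        rw [← e1, e2]
        simp [Machine.exec, increment, popBuf, pushBuf, c, hy, e3, unary_succ]
      · omega
    · by_cases h : j = i
      · subst h; simpa using hx
      · simpa [h] using h3 j
    · rw [Function.update_of_ne (by rintro rfl; exact hi hj)]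
      exact h4 j (Finset.mem_insert_of_mem hj)
  · rw [hpeek]
    simp [unary]

/-! ### Rules -/

/-- The condition that the bit `bit` of the cell with the indices `row` and `col` is `val`. -/
structure Atom where
  row : Fin 6
  col : Fin 6
  bit : Fin 9
  val : Bool

/-- If all atoms in `body` are true, then set a bit. -/
structure Rule where
  body : List Atom
  row : Fin 6
  col : Fin 6
  bit : Fin 9

def Atom.eval (A : Atom) (e : Env) (M : Mem) : Bool :=
  M (e A.row) (e A.col) A.bit == A.val

def Rule.Fires (R : Rule) (e : Env) (M : Mem) : Prop :=
  ∀ A ∈ R.body, A.eval e M = true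

open Classical in
/-- Apply a rule. -/
noncomputable def Rule.apply (R : Rule) (e : Env) (M : Mem) : Mem :=
  if R.Fires e M then
    setCell M (e R.row) (e R.col) (Function.update (M (e R.row) (e R.col)) R.bit true)
  else M

/-- The columns of a memory access are not indexed by `rowReg`. -/
def Rule.Legal (R : Rule) : Prop :=
  (∀ A ∈ R.body, A.col ≠ rowReg) ∧ R.col ≠ rowReg

theorem setCell_self (M : Mem) (i j : ℕ) : setCell M i j (M i j) = M := by
  funext a b
  unfold setCell
  split_ifs with h
  · rw [h.1, h.2]
  · rfl

/-- Since `n ≤ N`, every register is a valid row index, but `rowReg` may be too large for a column.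
-/
theorem access_bounds {n N : ℕ} (h : n ≤ N) {e : Env} (he : ∀ i, e i < bound n N i) (i : Fin 6)
    {j : Fin 6} (hj : j ≠ rowReg) : e i < N ∧ e j < n := by
  have h1 := he i
  have h2 := he j
  unfold bound at h1 h2
  rw [if_neg hj] at h2
  split_ifs at h1 <;> omega

/-- The cost of a memory access. -/
noncomputable def accessCost : Polynomial ℕ :=
  20 * (Polynomial.X + 1) * (Polynomial.X + 1)

theorem le_accessCost {n N m : ℕ} (h : n ≤ N) (h' : N ≤ m) :
    20 * (N + 1) * (n + 1) ≤ accessCost.eval m := by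
  simp only [accessCost, Polynomial.eval_mul, Polynomial.eval_add, Polynomial.eval_X,
    Polynomial.eval_one, Polynomial.eval_ofNat]
  gcongr
  omega

/-- The flag accumulates the conjunction; each test is an access that writes the cell back
unchanged. -/
theorem realizable_atoms (L : List Atom) (hL : ∀ A ∈ L, A.col ≠ rowReg) :
    ∃ (P : Prog) (p : Polynomial ℕ), ∀ (m n N : ℕ) (e : Env) (M : Mem) (a : Bool), n ≤ N → N ≤ m →
    (∀ i, e i < bound n N i) →
      P.Runs (p.eval m) (rep n N e a M) (rep n N e (a && L.all fun A => A.eval e M) M) := by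
  induction L with
  | nil =>
    refine ⟨.basic clearBuf, 1, fun m n N e M a _ _ _ => ?_⟩
    refine (Machine.runs_basic clearBuf (rep n N e a M)).congr rfl ?_ (by simp)
    simp [Machine.exec, clearBuf, rep]
  | cons A L ih =>
    obtain ⟨P, p, hP⟩ := ih fun B hB => hL B (List.mem_cons_of_mem A hB)
    refine ⟨.seq (access A.row A.col fun c a => (c, a && (c A.bit == A.val))) P,
      accessCost + p, fun m n N e M a h1 h2 h3 => ?_⟩
    obtain ⟨h4, h5⟩ := access_bounds h1 h3 A.row (hL A List.mem_cons_self)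
    have h6 := runs_access A.row A.col (fun c a => (c, a && (c A.bit == A.val))) (a := a) (M := M)
      h4 h5
    rw [setCell_self] at h6
    rw [Polynomial.eval_add]
    refine ((h6.mono (le_accessCost h1 h2)).seq (hP m n N e M _ h1 h2 h3)).congr rfl ?_ le_rfl
    simp [Atom.eval, Bool.and_assoc]

/-- The flag decides whether the head cell is changed, and the same access resets it to `true` for
the next rule. -/
theorem Rule.Legal.realizable {R : Rule} (hR : R.Legal) :
    Realizable ∅ fun _ _ e M => R.apply e M := by
  classical
  obtain ⟨P, p, hP⟩ := realizable_atoms R.body hR.1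
  let g : Cell → Bool → Cell × Bool := fun c a => (if a then Function.update c R.bit true else c,
    true)
  refine ⟨.seq P (access R.row R.col g), p + accessCost, fun m n N e M h1 h2 h3 _ => ?_⟩
  obtain ⟨h4, h5⟩ := access_bounds h1 h3 R.row hR.2
  have h6 := runs_access R.row R.col g (a := true && R.body.all fun A => A.eval e M) (M := M)
    h4 h5
  rw [Polynomial.eval_add]
  refine ((hP m n N e M true h1 h2 h3).seq (h6.mono (le_accessCost h1 h2))).congr rfl ?_ le_rfl
  have h7 : (true && R.body.all fun A => A.eval e M) = true ↔ R.Fires e M := by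
    simp [Rule.Fires]
  by_cases h : R.Fires e M
  · rw [h7.2 h]
    simp [g, Rule.apply, h]
  · rw [Bool.eq_false_iff.2 (mt h7.1 h)]
    simp [g, Rule.apply, h, setCell_self]

/-- Apply a rule for all values of some registers. -/
noncomputable def sweep (R : Rule) : List (Fin 6) → ℕ → ℕ → Env → Mem → Mem
  | [] => fun _ _ e M => R.apply e M
  | i :: l => forEach i (sweep R l)

theorem Rule.Legal.sweep {R : Rule} (hR : R.Legal) {l : List (Fin 6)} (hl : l.Nodup) :
    Realizable l.toFinset (sweep R l) := by
  induction l with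
  | nil => exact hR.realizable
  | cons i l ih =>
    rw [List.nodup_cons] at hl
    rw [List.toFinset_cons]
    exact (ih hl.2).forEach (by simpa using hl.1)

/-- The body never reads the bit that the rule writes. So earlier applications do not affect later
ones, and all of them act as if simultaneously on the original `M`. -/
theorem foldl_apply {R : Rule} (hR : ∀ A ∈ R.body, A.bit ≠ R.bit) (L : List Env) (M : Mem)
    (a b : ℕ) (t : Fin 9) : L.foldl (fun M e => R.apply e M) M a b t = true ↔ M a b t = true ∨
      ∃ e ∈ L, R.Fires e M ∧ a = e R.row ∧ b = e R.col ∧ t = R.bit := by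
  induction L generalizing M with
  | nil => simp
  | cons e L ih =>
    have h1 : ∀ a b t, R.apply e M a b t = true ↔ M a b t = true ∨
        (R.Fires e M ∧ a = e R.row ∧ b = e R.col ∧ t = R.bit) := by
      intro a b t
      unfold Rule.apply
      split_ifs with h
      · unfold setCell
        split_ifs with h'
        · obtain ⟨rfl, rfl⟩ := h'
          by_cases ht : t = R.bit
          · subst ht; simp [h]
          · simp [ht]
        · have : ¬ (R.Fires e M ∧ a = e R.row ∧ b = e R.col ∧ t = R.bit) := fun h2 =>
            h' ⟨h2.2.1, h2.2.2.1⟩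
          simp [this]
      · simp [h]
    have h2 : ∀ e', R.Fires e' (R.apply e M) ↔ R.Fires e' M := by
      intro e'
      have h3 : ∀ A ∈ R.body, A.eval e' (R.apply e M) = A.eval e' M := by
        intro A hA
        have := h1 (e' A.row) (e' A.col) A.bit
        simp only [hR A hA, and_false, or_false] at this
        unfold Atom.eval
        rw [Bool.eq_iff_iff.2 this]
      unfold Rule.Fires
      exact forall₂_congr fun A hA => by rw [h3 A hA]
    rw [List.foldl_cons, ih, h1]
    simp only [h2, List.exists_mem_cons_iff]
    tauto

/-- The environments that a sweep goes through. -/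
def envs (n N : ℕ) : List (Fin 6) → Env → List Env
  | [], e => [e]
  | i :: l, e => (List.range (bound n N i)).flatMap fun x => envs n N l (Function.update e i x)

theorem sweep_eq_foldl (R : Rule) (l : List (Fin 6)) (n N : ℕ) (e : Env) (M : Mem) :
    sweep R l n N e M = (envs n N l e).foldl (fun M e => R.apply e M) M := by
  induction l generalizing e M with
  | nil => rfl
  | cons i l ih =>
    simp only [sweep, forEach, envs, List.foldl_flatMap, ih]

theorem mem_envs {n N : ℕ} {l : List (Fin 6)} (hl : l.Nodup) {e e' : Env} :
    e' ∈ envs n N l e ↔ (∀ i ∈ l, e' i < bound n N i) ∧ ∀ i, i ∉ l → e' i = e i := by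
  induction l generalizing e with
  | nil => simp [envs, funext_iff]
  | cons i l ih =>
    rw [List.nodup_cons] at hl
    simp only [envs, List.mem_flatMap, List.mem_range, ih hl.2]
    constructor
    · rintro ⟨x, hx, h1, h2⟩
      refine ⟨fun j hj => ?_, fun j hj => ?_⟩
      · rcases List.mem_cons.1 hj with rfl | hj
        · rw [h2 j hl.1]; simpa using hx
        · exact h1 j hj
      · rw [List.mem_cons, not_or] at hj
        rw [h2 j hj.2, Function.update_of_ne hj.1]
    · rintro ⟨h1, h2⟩
      refine ⟨e' i, h1 i List.mem_cons_self, fun j hj => h1 j (List.mem_cons_of_mem i hj),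
        fun j hj => ?_⟩
      by_cases h : j = i
      · subst h; simp
      · rw [Function.update_of_ne h, h2 j (by simp [h, hj])]

/-- Swept registers become existentially quantified variables; the others are parameters. -/
theorem sweep_apply {R : Rule} (hR : ∀ A ∈ R.body, A.bit ≠ R.bit) {l : List (Fin 6)}
    (hl : l.Nodup) {n N : ℕ} {e : Env} {M : Mem} {a b : ℕ} {t : Fin 9} :
    sweep R l n N e M a b t = true ↔ M a b t = true ∨
      ∃ e' : Env, (∀ i ∈ l, e' i < bound n N i) ∧ (∀ i, i ∉ l → e' i = e i) ∧ R.Fires e' M ∧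
        a = e' R.row ∧ b = e' R.col ∧ t = R.bit := by
  rw [sweep_eq_foldl, foldl_apply hR]
  simp only [mem_envs hl, and_assoc]

/-! ### The decision procedure

The index registers are `a = 0`, `b = 1`, `c = 2`, the row register `r = 3`, a register `s = 4` for
the initial vertex, and a register `z = 5` for the constant zero. The bits of a cell stand for the
following matrices: edges, and later reachability (`0`), the reachability sets (`2`), equality
(`3`), conflicts (`4`), the relation `Forces`, and later its closure (`5`), vertices that cannot be
chosen (`7`), failure (`8`), and auxiliary matrices (`1` and `6`). -/

theorem exists_env {p : Env → Prop} :
    (∃ e, p e) ↔ ∃ a b c r s z, p ![a, b, c, r, s, z] := by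
  constructor
  · rintro ⟨e, he⟩
    refine ⟨e 0, e 1, e 2, e 3, e 4, e 5, ?_⟩
    convert he
    funext i
    fin_cases i <;> rfl
  · rintro ⟨a, b, c, r, s, z, h⟩
    exact ⟨_, h⟩

/-- Mark the diagonal with the bit `t`. -/
noncomputable def markDiagonal (t : Fin 9) : ℕ → ℕ → Env → Mem → Mem :=
  sweep ⟨[], 0, 0, t⟩ [0]

theorem markDiagonal_apply {t t' : Fin 9} {n N c s a b : ℕ} {M : Mem} :
    markDiagonal t n N ![0, 0, c, 0, s, 0] M a b t' = true ↔
      M a b t' = true ∨ (a < n ∧ a = b ∧ t' = t) := by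
  rw [markDiagonal, sweep_apply (by simp) (by simp), exists_env]
  simp [Fin.forall_fin_succ, Rule.Fires, bound, rowReg]
  grind

/-- One Warshall round with pivot in register `2`. The new pairs go to the auxiliary matrix `t₂`, as
a rule must not read the bit it writes, and are then copied by `closureUnion`. -/
noncomputable def closureCompose (t t₂ : Fin 9) : ℕ → ℕ → Env → Mem → Mem :=
  sweep ⟨[⟨0, 2, t, true⟩, ⟨2, 1, t, true⟩], 0, 1, t₂⟩ [0, 1]

theorem closureCompose_apply {t t₂ t' : Fin 9} (h : t ≠ t₂) {n N c s a b : ℕ} {M : Mem} :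
    closureCompose t t₂ n N ![0, 0, c, 0, s, 0] M a b t' = true ↔ M a b t' = true ∨
      (a < n ∧ b < n ∧ t' = t₂ ∧ M a c t = true ∧ M c b t = true) := by
  rw [closureCompose, sweep_apply (by simp [h]) (by simp), exists_env]
  simp [Fin.forall_fin_succ, Rule.Fires, Atom.eval, bound, rowReg]
  grind

noncomputable def closureUnion (t t₂ : Fin 9) : ℕ → ℕ → Env → Mem → Mem :=
  sweep ⟨[⟨0, 1, t₂, true⟩], 0, 1, t⟩ [0, 1]

theorem closureUnion_apply {t t₂ t' : Fin 9} (h : t ≠ t₂) {n N c s a b : ℕ} {M : Mem} :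
    closureUnion t t₂ n N ![0, 0, c, 0, s, 0] M a b t' = true ↔ M a b t' = true ∨
      (a < n ∧ b < n ∧ t' = t ∧ M a b t₂ = true) := by
  rw [closureUnion, sweep_apply (by simp [h.symm]) (by simp), exists_env]
  simp [Fin.forall_fin_succ, Rule.Fires, Atom.eval, bound, rowReg]
  grind

/-- Warshall's algorithm for the matrix `t`, with the auxiliary matrix `t₂`. -/
noncomputable def closure (t t₂ : Fin 9) : ℕ → ℕ → Env → Mem → Mem :=
  forEach 2 fun n N e M => closureUnion t t₂ n N e (closureCompose t t₂ n N e M)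

theorem closure_apply {t t₂ : Fin 9} (h : t ≠ t₂) {n N s : ℕ} {M : Mem}
    (hM : ∀ a b, M a b t₂ = false) :
    (∀ a b t', t' ≠ t → t' ≠ t₂ →
      closure t t₂ n N ![0, 0, 0, 0, s, 0] M a b t' = M a b t') ∧
    ∀ a < n, ∀ b < n, (closure t t₂ n N ![0, 0, 0, 0, s, 0] M a b t = true ↔
      warshall (fun a b => M a b t = true) n a b) := by
  have hb : bound n N 2 = n := by simp [bound, rowReg]
  have he : ∀ x, Function.update (![0, 0, 0, 0, s, 0] : Env) 2 x = ![0, 0, x, 0, s, 0] := by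
    intro x
    funext i
    fin_cases i <;> rfl
  unfold closure forEach
  simp only [hb, he]
  -- The auxiliary matrix is not cleared between rounds. The second clause of the invariant makes
  -- this harmless: its old entries are already in `t`.
  suffices key : ∀ x ≤ n, ∀ M', M' = (List.range x).foldl (fun M x =>
      closureUnion t t₂ n N ![0, 0, x, 0, s, 0]
        (closureCompose t t₂ n N ![0, 0, x, 0, s, 0] M)) M →
      (∀ a b t', t' ≠ t → t' ≠ t₂ → M' a b t' = M a b t') ∧
      (∀ a < n, ∀ b < n, M' a b t₂ = true → M' a b t = true) ∧
      ∀ a < n, ∀ b < n, (M' a b t = true ↔ warshall (fun a b => M a b t = true) x a b) by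
    obtain ⟨h1, -, h2⟩ := key n le_rfl _ rfl
    exact ⟨h1, h2⟩
  intro x
  induction x with
  | zero =>
    rintro - M' rfl
    simp [hM, warshall]
  | succ x ih =>
    intro hx M' hM'
    rw [List.range_succ, List.foldl_append, List.foldl_cons, List.foldl_nil] at hM'
    obtain ⟨h1, h2, h3⟩ := ih (by omega) _ rfl
    generalize (List.range x).foldl (fun M x =>
      closureUnion t t₂ n N ![0, 0, x, 0, s, 0]
        (closureCompose t t₂ n N ![0, 0, x, 0, s, 0] M)) M = M₁ at *
    subst hM'
    refine ⟨fun a b t' ht ht₂ => ?_, fun a ha b hb => ?_, fun a ha b hb => ?_⟩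
    · rw [Bool.eq_iff_iff, closureUnion_apply h, closureCompose_apply h]
      simp [ht, ht₂, h1 a b t' ht ht₂]
    · rw [closureUnion_apply h, closureUnion_apply h, closureCompose_apply h]
      grind
    · rw [closureUnion_apply h, closureCompose_apply h, closureCompose_apply h]
      simp only [h, false_and, and_false, or_false, ha, hb, true_and]
      rw [warshall, ← h3 a ha b hb, ← h3 a ha x hx, ← h3 x hx b hb]
      have := h2 a ha b hb
      tauto

/-- Mark the pairs of incomparable vertices, and the pairs with an unreachable vertex. -/
noncomputable def markConflicts : ℕ → ℕ → Env → Mem → Mem := fun n N e M =>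
  sweep ⟨[⟨4, 1, 0, false⟩], 0, 1, 4⟩ [0, 1] n N e <|
    sweep ⟨[⟨4, 0, 0, false⟩], 0, 1, 4⟩ [0, 1] n N e <|
      sweep ⟨[⟨0, 1, 0, false⟩, ⟨1, 0, 0, false⟩], 0, 1, 4⟩ [0, 1] n N e M

theorem markConflicts_apply {t : Fin 9} {n N c s a b : ℕ} {M : Mem} :
    markConflicts n N ![0, 0, c, 0, s, 0] M a b t = true ↔ M a b t = true ∨
      (a < n ∧ b < n ∧ t = 4 ∧ ((¬ M a b 0 = true ∧ ¬ M b a 0 = true) ∨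
        ¬ M s a 0 = true ∨ ¬ M s b 0 = true)) := by
  have h1 : ∀ (M : Mem) (a b : ℕ) (t : Fin 9),
      sweep ⟨[⟨0, 1, 0, false⟩, ⟨1, 0, 0, false⟩], 0, 1, 4⟩ [0, 1] n N ![0, 0, c, 0, s, 0] M a b t
        = true ↔ M a b t = true ∨
        (a < n ∧ b < n ∧ t = 4 ∧ ¬ M a b 0 = true ∧ ¬ M b a 0 = true) := by
    intro M a b t
    rw [sweep_apply (by simp) (by simp), exists_env]
    simp [Fin.forall_fin_succ, Rule.Fires, Atom.eval, bound, rowReg]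
    grind
  have h2 : ∀ (M : Mem) (a b : ℕ) (t : Fin 9),
      sweep ⟨[⟨4, 0, 0, false⟩], 0, 1, 4⟩ [0, 1] n N ![0, 0, c, 0, s, 0] M a b t = true ↔
        M a b t = true ∨ (a < n ∧ b < n ∧ t = 4 ∧ ¬ M s a 0 = true) := by
    intro M a b t
    rw [sweep_apply (by simp) (by simp), exists_env]
    simp [Fin.forall_fin_succ, Rule.Fires, Atom.eval, bound, rowReg]
    grind
  have h3 : ∀ (M : Mem) (a b : ℕ) (t : Fin 9),
      sweep ⟨[⟨4, 1, 0, false⟩], 0, 1, 4⟩ [0, 1] n N ![0, 0, c, 0, s, 0] M a b t = true ↔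
        M a b t = true ∨ (a < n ∧ b < n ∧ t = 4 ∧ ¬ M s b 0 = true) := by
    intro M a b t
    rw [sweep_apply (by simp) (by simp), exists_env]
    simp [Fin.forall_fin_succ, Rule.Fires, Atom.eval, bound, rowReg]
    grind
  -- All three sweeps read bit `0` and write bit `4`, so they do not interfere.
  have h4 : (0 : Fin 9) ≠ 4 := by decide
  unfold markConflicts
  rw [h3, h2, h2, h1, h1, h1]
  simp only [h4, false_and, and_false, or_false]
  tauto

/-- Mark the pairs of vertices for which the choice of the first one forces that of the second. -/
noncomputable def markForces : ℕ → ℕ → Env → Mem → Mem :=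
  sweep ⟨[⟨3, 1, 2, true⟩, ⟨3, 2, 2, true⟩, ⟨1, 2, 3, false⟩, ⟨0, 1, 4, true⟩], 0, 2, 5⟩ [0, 1, 2, 3]

theorem markForces_apply {t : Fin 9} {n N s a c : ℕ} {M : Mem} :
    markForces n N ![0, 0, 0, 0, s, 0] M a c t = true ↔ M a c t = true ∨
      (a < n ∧ c < n ∧ t = 5 ∧ ∃ r < N, ∃ b < n, M r b 2 = true ∧ M r c 2 = true ∧
        ¬ M b c 3 = true ∧ M a b 4 = true) := by
  rw [markForces, sweep_apply (by simp) (by simp), exists_env]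
  simp [Fin.forall_fin_succ, Rule.Fires, Atom.eval, bound, rowReg]
  grind

/-- Mark the vertices whose choice leads to a conflict. -/
noncomputable def markBad : ℕ → ℕ → Env → Mem → Mem :=
  sweep ⟨[⟨0, 1, 5, true⟩, ⟨0, 1, 4, true⟩], 0, 0, 7⟩ [0, 1]

theorem markBad_apply {t : Fin 9} {n N s a a' : ℕ} {M : Mem} :
    markBad n N ![0, 0, 0, 0, s, 0] M a a' t = true ↔ M a a' t = true ∨
      (a < n ∧ a = a' ∧ t = 7 ∧ ∃ b < n, M a b 5 = true ∧ M a b 4 = true) := by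
  rw [markBad, sweep_apply (by simp) (by simp), exists_env]
  simp [Fin.forall_fin_succ, Rule.Fires, Atom.eval, bound, rowReg]
  grind

/-- Mark the failure bit, if no vertex of some color can be chosen. -/
noncomputable def markFailure : ℕ → ℕ → Env → Mem → Mem :=
  sweep ⟨[⟨3, 0, 2, true⟩, ⟨3, 1, 2, true⟩, ⟨0, 1, 3, false⟩, ⟨0, 0, 7, true⟩, ⟨1, 1, 7, true⟩],
    5, 5, 8⟩ [0, 1, 3]

theorem markFailure_apply {n N s : ℕ} {M : Mem} :
    markFailure n N ![0, 0, 0, 0, s, 0] M 0 0 8 = true ↔ M 0 0 8 = true ∨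
      ∃ a < n, ∃ b < n, ∃ r < N, M r a 2 = true ∧ M r b 2 = true ∧
        ¬ M a b 3 = true ∧ M a a 7 = true ∧ M b b 7 = true := by
  rw [markFailure, sweep_apply (by simp) (by simp), exists_env]
  simp [Fin.forall_fin_succ, Rule.Fires, Atom.eval, bound, rowReg]
  refine or_congr_right ⟨?_, ?_⟩
  · rintro ⟨a, b, r, ⟨ha, hb, hr⟩, h⟩
    exact ⟨a, ha, b, hb, r, hr, h⟩
  · rintro ⟨a, ha, b, hb, r, hr, h⟩
    exact ⟨a, b, r, ⟨ha, hb, hr⟩, h⟩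

/-- The whole procedure. -/
noncomputable def solve : ℕ → ℕ → Env → Mem → Mem := fun n N e M =>
  markFailure n N e <| markBad n N e <| closure 5 6 n N e <| markDiagonal 5 n N e <|
    markForces n N e <| markConflicts n N e <| closure 0 1 n N e <|
      markDiagonal 3 n N e <| markDiagonal 0 n N e M

/-- Registers `4` and `5` are never swept, so they keep the initial vertex and zero throughout. -/
theorem realizable_solve : Realizable {0, 1, 2, 3} solve := by
  have hd : ∀ t, Realizable {0, 1, 2, 3} (markDiagonal t) := fun t =>
    (Rule.Legal.sweep (by simp [Rule.Legal, rowReg]) (by simp)).mono (by simp)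
  have hc : ∀ t t₂, Realizable {0, 1, 2, 3} (closure t t₂) := fun t t₂ =>
    (Realizable.forEach (s := {0, 1}) (.comp
      ((Rule.Legal.sweep (by simp [Rule.Legal, rowReg]) (by simp)).mono (by simp))
      ((Rule.Legal.sweep (by simp [Rule.Legal, rowReg]) (by simp)).mono (by simp)))
      (by simp)).mono (by decide)
  have hs : ∀ R : Rule, R.Legal → Realizable {0, 1, 2, 3} (sweep R [0, 1]) := fun R hR =>
    (hR.sweep (by simp)).mono (by decide)
  have hm : Realizable {0, 1, 2, 3} markConflicts :=
    ((hs ⟨[⟨0, 1, 0, false⟩, ⟨1, 0, 0, false⟩], 0, 1, 4⟩ (by simp [Rule.Legal, rowReg])).comp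
      (hs ⟨[⟨4, 0, 0, false⟩], 0, 1, 4⟩ (by simp [Rule.Legal, rowReg]))).comp
      (hs ⟨[⟨4, 1, 0, false⟩], 0, 1, 4⟩ (by simp [Rule.Legal, rowReg]))
  have hf : Realizable {0, 1, 2, 3} markForces :=
    (Rule.Legal.sweep (by simp [Rule.Legal, rowReg]) (by simp)).mono (by decide)
  have hb : Realizable {0, 1, 2, 3} markBad :=
    (Rule.Legal.sweep (by simp [Rule.Legal, rowReg]) (by simp)).mono (by decide)
  have hF : Realizable {0, 1, 2, 3} markFailure :=
    (Rule.Legal.sweep (by simp [Rule.Legal, rowReg]) (by simp)).mono (by decide)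
  exact (hd 0).comp <| (hd 3).comp <| (hc 0 1).comp <| hm.comp <| hf.comp <| (hd 5).comp <|
    (hc 5 6).comp <| hb.comp hF

/-- The matrices are followed through the phases; each phase leaves all bits but its own unchanged,
so earlier results stay available. The row register also passes over the adjacency rows, where `hMF`
excludes bit `2`. Inequality of vertices is read off from the stored diagonal, as rules can only
test bits. -/
theorem solve_apply {n k N : ℕ} {A : Arena (Fin n)} {F : Fin k → Set (Fin n)}
    (hF : ∀ i, (F i).ncard = 2) {s : Fin n} {M : Mem}
    (hM : ∀ a b t, t ≠ 0 → t ≠ 2 → M a b t = false)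
    (hE : ∀ u v : Fin n, M u v 0 = true ↔ A.edge u v)
    (hMF : ∀ r, ∀ v : Fin n, (r < N ∧ M r v 2 = true) ↔ ∃ i : Fin k, r = n + i ∧ v ∈ F i) :
    solve n N ![0, 0, 0, 0, s, 0] M 0 0 8 = false ↔
      ∃ S : Set (Fin n), (∀ u ∈ S, ∀ v ∈ S, ¬ A.Conflict s u v) ∧ ∀ i, ∃ v ∈ F i, v ∈ S := by
  rw [exists_transversal_iff (fun u v => Arena.Conflict.symm) hF]
  unfold solve
  set e : Env := ![0, 0, 0, 0, s, 0]
  -- reachability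
  set M₁ := markDiagonal 3 n N e (markDiagonal 0 n N e M)
  have hM₁ : ∀ a b t, t ≠ 0 → t ≠ 3 → M₁ a b t = M a b t := by
    intro a b t h0 h3
    rw [Bool.eq_iff_iff, markDiagonal_apply, markDiagonal_apply]
    simp [h0, h3]
  have h10 : ∀ u v : Fin n, M₁ u v 0 = true ↔ A.edge u v ∨ u = v := by
    intro u v
    rw [markDiagonal_apply, markDiagonal_apply, hE]
    simp [Fin.ext_iff]
  have h13 : ∀ u v : Fin n, M₁ u v 3 = true ↔ u = v := by
    intro u v
    rw [markDiagonal_apply, markDiagonal_apply, hM _ _ _ (by decide) (by decide)]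
    simp [Fin.ext_iff]
  obtain ⟨hM₂, h20⟩ := closure_apply (t := 0) (t₂ := 1) (by decide) (n := n) (N := N) (s := s)
    (M := M₁) fun a b => by rw [hM₁ _ _ _ (by decide) (by decide), hM _ _ _ (by decide) (by decide)]
  set M₂ := closure 0 1 n N e M₁
  replace h20 : ∀ u v : Fin n, M₂ u v 0 = true ↔ A.Reachable u v := fun u v =>
    (h20 u u.2 v v.2).trans (warshall_iff_reflTransGen h10 u v)
  -- conflicts
  set M₃ := markConflicts n N e M₂
  have hM₃ : ∀ a b t, t ≠ 4 → M₃ a b t = M₂ a b t := by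
    intro a b t h4
    rw [Bool.eq_iff_iff, markConflicts_apply]
    simp [h4]
  have h34 : ∀ u v : Fin n, M₃ u v 4 = true ↔ A.Conflict s u v := by
    intro u v
    rw [markConflicts_apply, hM₂ _ _ _ (by decide) (by decide), hM₁ _ _ _ (by decide) (by decide),
      hM _ _ _ (by decide) (by decide), h20, h20, h20, h20]
    simp [Arena.Conflict]
  -- forced choices
  have h32 : ∀ a b, M₃ a b 2 = M a b 2 := fun a b => by
    rw [hM₃ _ _ _ (by decide), hM₂ _ _ _ (by decide) (by decide), hM₁ _ _ _ (by decide) (by decide)]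
  have h33 : ∀ u v : Fin n, M₃ u v 3 = true ↔ u = v := fun u v => by
    rw [hM₃ _ _ _ (by decide), hM₂ _ _ _ (by decide) (by decide), h13]
  set M₄ := markForces n N e M₃
  have hM₄ : ∀ a b t, t ≠ 5 → M₄ a b t = M₃ a b t := by
    intro a b t h5
    rw [Bool.eq_iff_iff, markForces_apply]
    simp [h5]
  have h45 : ∀ u v : Fin n, M₄ u v 5 = true ↔ Forces (A.Conflict s) F u v := by
    intro u v
    rw [markForces_apply, hM₃ _ _ _ (by decide), hM₂ _ _ _ (by decide) (by decide),
      hM₁ _ _ _ (by decide) (by decide), hM _ _ _ (by decide) (by decide)]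
    simp only [Bool.false_eq_true, false_or, u.2, v.2, true_and, h32]
    constructor
    · rintro ⟨r, hr, b, hb, h1, h2, h3, h4⟩
      obtain ⟨i, hi, hi'⟩ := (hMF r ⟨b, hb⟩).1 ⟨hr, h1⟩
      obtain ⟨j, hj, hj'⟩ := (hMF r v).1 ⟨hr, h2⟩
      obtain rfl : i = j := Fin.ext (by omega)
      exact ⟨i, ⟨b, hb⟩, hi', hj', mt (h33 ⟨b, hb⟩ v).2 h3, (h34 u ⟨b, hb⟩).1 h4⟩
    · rintro ⟨i, b, h1, h2, h3, h4⟩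
      obtain ⟨h5, h6⟩ := (hMF _ b).2 ⟨i, rfl, h1⟩
      exact ⟨_, h5, b, b.2, h6, ((hMF _ v).2 ⟨i, rfl, h2⟩).2, mt (h33 b v).1 h3, (h34 u b).2 h4⟩
  set M₅ := markDiagonal 5 n N e M₄
  have hM₅ : ∀ a b t, t ≠ 5 → M₅ a b t = M₃ a b t := by
    intro a b t h5
    rw [← hM₄ a b t h5, Bool.eq_iff_iff, markDiagonal_apply]
    simp [h5]
  have h55 : ∀ u v : Fin n, M₅ u v 5 = true ↔ Forces (A.Conflict s) F u v ∨ u = v := by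
    intro u v
    rw [markDiagonal_apply, h45]
    simp [Fin.ext_iff]
  obtain ⟨hM₆, h65⟩ := closure_apply (t := 5) (t₂ := 6) (by decide) (n := n) (N := N) (s := s)
    (M := M₅) fun a b => by
      rw [hM₅ _ _ _ (by decide), hM₃ _ _ _ (by decide), hM₂ _ _ _ (by decide) (by decide),
        hM₁ _ _ _ (by decide) (by decide), hM _ _ _ (by decide) (by decide)]
  set M₆ := closure 5 6 n N e M₅
  replace h65 : ∀ u v : Fin n,
      M₆ u v 5 = true ↔ Relation.ReflTransGen (Forces (A.Conflict s) F) u v := fun u v =>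
    (h65 u u.2 v v.2).trans (warshall_iff_reflTransGen h55 u v)
  replace hM₆ : ∀ a b t, t ≠ 5 → t ≠ 6 → M₆ a b t = M₃ a b t := fun a b t h5 h6 => by
    rw [hM₆ a b t h5 h6, hM₅ a b t h5]
  -- vertices that cannot be chosen
  set M₇ := markBad n N e M₆
  have hM₇ : ∀ a b t, t ≠ 5 → t ≠ 6 → t ≠ 7 → M₇ a b t = M₃ a b t := by
    intro a b t h5 h6 h7
    rw [← hM₆ a b t h5 h6, Bool.eq_iff_iff, markBad_apply]
    simp [h7]
  have h77 : ∀ v : Fin n, M₇ v v 7 = true ↔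
      ∃ t, Relation.ReflTransGen (Forces (A.Conflict s) F) v t ∧ A.Conflict s v t := by
    intro v
    rw [markBad_apply, hM₆ _ _ _ (by decide) (by decide), hM₃ _ _ _ (by decide),
      hM₂ _ _ _ (by decide) (by decide), hM₁ _ _ _ (by decide) (by decide),
      hM _ _ _ (by decide) (by decide)]
    simp only [Bool.false_eq_true, false_or, v.2, true_and]
    constructor
    · rintro ⟨b, hb, h1, h2⟩
      refine ⟨⟨b, hb⟩, (h65 v ⟨b, hb⟩).1 h1, (h34 v ⟨b, hb⟩).1 ?_⟩
      rwa [hM₆ _ _ _ (by decide) (by decide)] at h2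
    · rintro ⟨b, h1, h2⟩
      refine ⟨b, b.2, (h65 v b).2 h1, ?_⟩
      rw [hM₆ _ _ _ (by decide) (by decide)]
      exact (h34 v b).2 h2
  -- Both sides are negated: failure means that some color has only bad elements.
  rw [← Bool.not_eq_true, not_iff_comm, markFailure_apply, hM₇ _ _ _ (by decide) (by decide)
    (by decide), hM₃ _ _ _ (by decide), hM₂ _ _ _ (by decide) (by decide),
    hM₁ _ _ _ (by decide) (by decide), hM _ _ _ (by decide) (by decide)]
  have h72 : ∀ a b, M₇ a b 2 = M a b 2 := fun a b => by
    rw [hM₇ _ _ _ (by decide) (by decide) (by decide), h32]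
  have h73 : ∀ u v : Fin n, M₇ u v 3 = true ↔ u = v := fun u v => by
    rw [hM₇ _ _ _ (by decide) (by decide) (by decide), h33]
  simp only [Bool.false_eq_true, false_or, h72]
  push Not
  constructor
  · rintro ⟨i, hi⟩
    obtain ⟨x, y, hxy, hFi⟩ := Set.ncard_eq_two.1 (hF i)
    have hx : x ∈ F i := by rw [hFi]; simp
    have hy : y ∈ F i := by rw [hFi]; simp
    obtain ⟨h5, h6⟩ := (hMF _ x).2 ⟨i, rfl, hx⟩
    exact ⟨x, x.2, y, y.2, _, h5, h6, ((hMF _ y).2 ⟨i, rfl, hy⟩).2,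
      by simpa using mt (h73 x y).1 hxy, (h77 x).2 (hi x hx), (h77 y).2 (hi y hy)⟩
  · rintro ⟨a, ha, b, hb, r, hr, h1, h2, h3, h4, h5⟩
    obtain ⟨i, hi, hi'⟩ := (hMF r ⟨a, ha⟩).1 ⟨hr, h1⟩
    obtain ⟨j, hj, hj'⟩ := (hMF r ⟨b, hb⟩).1 ⟨hr, h2⟩
    obtain rfl : i = j := Fin.ext (by omega)
    refine ⟨i, fun v hv => ?_⟩
    have hab : (⟨a, ha⟩ : Fin n) ≠ ⟨b, hb⟩ := fun h => h3 ((h73 ⟨a, ha⟩ ⟨b, hb⟩).2 h)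
    -- Two distinct elements exhaust a target of size two.
    have hv' : v = ⟨a, ha⟩ ∨ v = ⟨b, hb⟩ := by
      obtain ⟨x, y, hxy, hFi⟩ := Set.ncard_eq_two.1 (hF i)
      rw [hFi] at hv hi' hj'
      simp only [Set.mem_insert_iff, Set.mem_singleton_iff] at hv hi' hj'
      grind
    rcases hv' with rfl | rfl
    · exact (h77 _).1 h4
    · exact (h77 _).1 h5

/-! ### Reading the input -/

/-- The working stacks while the input is read. -/
def reading (left right : List Sym) (x a r y : ℕ) : Work → List Sym :=
  work [] left right ![[], [], [], [], unary x, []]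
    ![unary a, unary a, unary a, unary r, unary y, unary a]

/-- Pop a letter from the input into the buffer, where it is represented as a cell in which only
the bit `t` may be set. -/
def popInp (t : Fin 9) : Line :=
  .pop .inp (fun v a => (v.1, a.map fun x => x.map fun b t' => b && t' == t)) .halt

def bitCell (t : Fin 9) (b : Bool) : Cell :=
  fun t' => b && t' == t

theorem exec_popInp_cons (t : Fin 9) {a : Bool} {c : Option Sym} {x : Option Bool}
    {w : List (Option Bool)} {o : List Bool} {f : Work → List Sym} :
    Machine.exec (popInp t) ((a, c), stk (x :: w) o f) =
      ((a, some (x.map (bitCell t))), stk w o f) := by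
  simp [Machine.exec, popInp]
  rfl

theorem exec_popInp_nil (t : Fin 9) {a : Bool} {c : Option Sym}
    {o : List Bool} {f : Work → List Sym} :
    Machine.exec (popInp t) ((a, c), stk [] o f) = ((a, none), stk [] o f) := by
  simp [Machine.exec, popInp]

/-- False both for a separator and for the empty buffer, so loops also stop at the end of the input.
-/
def isCell (v : Control) : Bool :=
  (v.2.getD none).isSome

/-- Read a bit vector and count its entries in the registers `0`, `1`, `2` and `5`. -/
def readLength : Prog :=
  .whileDo (popInp 0) isCell (.basic (.push (.work (.down 0)) (fun _ => none)
    (.push (.work (.down 1)) (fun _ => none) (.push (.work (.down 2)) (fun _ => none)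
      (pushSep (.down 5))))))

/-- Only the length `n` of the vector of Eve's vertices is recorded; its entries carry no
information in a one-player game. -/
theorem runs_readLength (l : List Bool) (w : List (Option Bool)) :
    readLength.Runs (l.length * 2 + 1)
      ((true, none), stk (l.map some ++ none :: w) [] (reading [] [] 0 0 0 0))
      ((true, some none), stk w [] (reading [] [] 0 l.length 0 0)) := by
  have key := Machine.runs_whileDo_list (q := popInp 0) (test := isCell)
    (P := .basic (.push (.work (.down 0)) (fun _ => none)
      (.push (.work (.down 1)) (fun _ => none) (.push (.work (.down 2)) (fun _ => none)
        (pushSep (.down 5))))))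
    (fun (l : List Bool) (x : ℕ) => ((true, none), stk (l.map some ++ none :: w) []
      (reading [] [] 0 x 0 0))) (fun x _ => x + 1) 1 ?_ ?_ l 0
  · refine key.congr rfl ?_ le_rfl
    rw [List.map_nil, List.nil_append, exec_popInp_cons]
    simp
  · intro b l x
    rw [List.map_cons, List.cons_append, exec_popInp_cons]
    refine ⟨rfl, (Machine.runs_basic _ _).congr rfl ?_ le_rfl⟩
    simp only [Machine.exec, pushSep, reading, stepAux, stk_work, update_stk_work, work_down,
      update_work_down]
    congr 3
    funext i
    fin_cases i <;> rfl
  · intro x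
    rw [List.map_nil, List.nil_append, exec_popInp_cons]
    rfl

/-- Read a bit vector and store the position of its first one in the register `4`. -/
def readPosition : Prog :=
  .whileDo (popInp 0) isCell (.basic (.branch
    (fun v => v.1 && !((v.2.getD none).getD default 0)) (pushSep (.up 4))
      (.load (fun v => (false, v.2)) (pushSep (.down 4)))))

/-- The effect of reading one bit: whether all bits were zero, how many zeros came first, and how
many other bits there were. -/
def countStep (c : Bool × ℕ × ℕ) (b : Bool) : Bool × ℕ × ℕ :=
  if c.1 && !b then (c.1, c.2.1 + 1, c.2.2) else (false, c.2.1, c.2.2 + 1)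

theorem runs_readPosition (l : List Bool) (w : List (Option Bool)) (n : ℕ) :
    readPosition.Runs (l.length * 2 + 1)
      ((true, none), stk (l.map some ++ none :: w) [] (reading [] [] 0 n 0 0))
      (((l.foldl countStep (true, 0, 0)).1, some none), stk w []
        (reading [] [] (l.foldl countStep (true, 0, 0)).2.1 n 0
          (l.foldl countStep (true, 0, 0)).2.2)) := by
  have key := Machine.runs_whileDo_list (q := popInp 0) (test := isCell)
    (P := .basic (.branch
      (fun v => v.1 && !((v.2.getD none).getD default 0)) (pushSep (.up 4))
        (.load (fun v => (false, v.2)) (pushSep (.down 4)))))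
    (fun (l : List Bool) (c : Bool × ℕ × ℕ) => ((c.1, none), stk (l.map some ++ none :: w) []
      (reading [] [] c.2.1 n 0 c.2.2))) countStep 1 ?_ ?_ l (true, 0, 0)
  · refine key.congr rfl ?_ le_rfl
    rw [List.map_nil, List.nil_append, exec_popInp_cons]
    simp
  · rintro b l ⟨a, x, y⟩
    rw [List.map_cons, List.cons_append, exec_popInp_cons]
    refine ⟨rfl, (Machine.runs_basic _ _).congr rfl ?_ le_rfl⟩
    have h1 : Function.update (![[], [], [], [], unary x, []] : Fin 6 → List Sym) 4
        (unary (x + 1)) = ![[], [], [], [], unary (x + 1), []] := by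
      funext i
      fin_cases i <;> rfl
    have h2 : Function.update (![unary n, unary n, unary n, unary 0, unary y, unary n] :
        Fin 6 → List Sym) 4 (unary (y + 1)) =
        ![unary n, unary n, unary n, unary 0, unary (y + 1), unary n] := by
      funext i
      fin_cases i <;> rfl
    have h3 : none :: (![[], [], [], [], unary x, []] : Fin 6 → List Sym) 4 = unary (x + 1) := rfl
    have h4 : none :: (![unary n, unary n, unary n, unary 0, unary y, unary n] :
        Fin 6 → List Sym) 4 = unary (y + 1) := rfl
    cases a <;> cases b <;> simp only [Machine.exec, pushSep, reading, stepAux, stk_work,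
      update_stk_work, work_down, update_work_down, work_up, update_work_up, countStep, bitCell,
      h1, h2, h3, h4, Option.map_some, Option.getD_some, Bool.false_and, Bool.true_and,
      Bool.not_true, Bool.not_false, cond_true, cond_false, beq_self_eq_true, if_true,
      Bool.false_eq_true, if_false]
  · intro x
    rw [List.map_nil, List.nil_append, exec_popInp_cons]
    rfl

/-- The one at position `s` is counted with the entries after it, which gives the complement `n - s`
required by `downs`. -/
theorem foldl_countStep {n : ℕ} (s : Fin n) :
    (List.ofFn fun v => decide (v = s)).foldl countStep (true, 0, 0) =
      (false, (s : ℕ), n - s) := by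
  have h1 : ∀ (l : List Bool) (x y : ℕ), l.foldl countStep (false, x, y) =
      (false, x, y + l.length) := by
    intro l
    induction l with
    | nil => simp
    | cons b l ih => intro x y; simp [countStep, ih]; omega
  have h2 : ∀ x, (List.ofFn fun v => decide (v = s)).foldl countStep (true, x, 0) =
      (false, x + (s : ℕ), n - s) := by
    induction n with
    | zero => exact s.elim0
    | succ n ih =>
      intro x
      cases s using Fin.cases with
      | zero => simp [List.ofFn_succ, countStep, h1]; omega
      | succ s =>
        have := ih s (x + 1)
        simp only [List.ofFn_succ, List.foldl_cons, Fin.succ_inj]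
        have h0 : decide ((0 : Fin (n + 1)) = s.succ) = false := by
          simp [Fin.ext_iff]
        rw [h0]
        simp only [countStep, Bool.not_false, Bool.and_self, if_true]
        rw [this]
        simp only [Fin.val_succ, Prod.mk.injEq, true_and]
        omega
  simpa using h2 0

/-- Read the rest of a bit vector. -/
def readCells (t : Fin 9) : Prog :=
  .whileDo (popInp t) isCell (.basic (pushBuf .left))

theorem runs_readCells (t : Fin 9) (l : List Bool) (w : List (Option Bool)) (left : List Sym)
    (x a r y : ℕ) : (readCells t).Runs (l.length * 2 + 1)
      ((true, none), stk (l.map some ++ none :: w) [] (reading left [] x a r y))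
      ((true, some none), stk w []
        (reading ((l.map fun b => some (bitCell t b)).reverse ++ left) [] x a r y)) := by
  have key := Machine.runs_whileDo_list (q := popInp t) (test := isCell)
    (P := .basic (pushBuf .left))
    (fun (l : List Bool) (c : List Sym) => ((true, none), stk (l.map some ++ none :: w) []
      (reading c [] x a r y))) (fun c b => some (bitCell t b) :: c) 1 ?_ ?_ l left
  · refine key.congr rfl ?_ le_rfl
    rw [List.map_nil, List.nil_append, exec_popInp_cons]
    have : ∀ (l : List Bool) (c : List Sym), l.foldl (fun c b => some (bitCell t b) :: c) c =
        (l.map fun b => some (bitCell t b)).reverse ++ c := by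
      intro l
      induction l with
      | nil => simp
      | cons b l ih => intro c; simp [ih]
    rw [this]
    rfl
  · intro b l c
    rw [List.map_cons, List.cons_append, exec_popInp_cons]
    refine ⟨rfl, (Machine.runs_basic _ _).congr rfl ?_ le_rfl⟩
    rw [Option.map_some, exec_pushBuf]
    simp [reading]
  · intro x
    rw [List.map_nil, List.nil_append, exec_popInp_cons]
    rfl

/-- Read bit vectors, up to a separator or the end of the input, and count them in the register
`3`. -/
def readRows (t : Fin 9) : Prog :=
  .whileDo (popInp t) isCell (.seq (.basic (pushBuf .left)) (.seq (readCells t)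
    (.basic (.push (.work (.down 3)) (fun _ => none) (pushSep .left)))))

/-- Vectors have positive length `m + 1`, so the first letter tells a further row from the closing
separator or the end of the input. That letter is popped by the test, hence pushed separately. -/
theorem runs_readRows (t : Fin 9) {m : ℕ} (l : List (Fin (m + 1) → Bool)) (w : List (Option Bool))
    (hw : (w.head?.getD none).isSome = false) (left : List Sym) (x a r y : ℕ) :
    (readRows t).Runs (l.length * (2 * m + 4) + 1)
      ((true, none), stk (l.flatMap (fun f => (List.ofFn fun v => some (f v)) ++ [none]) ++ w) []
        (reading left [] x a r y))
      ((true, w.head?.map fun _ => none), stk w.tail [] (reading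
        ((l.flatMap fun f => (List.ofFn fun v => some (bitCell t (f v))) ++ [none]).reverse ++ left)
        [] x a (r + l.length) y)) := by
  have hexec : ∀ f : Work → List Sym, Machine.exec (popInp t) ((true, none), stk w [] f) =
      ((true, w.head?.map fun _ => none), stk w.tail [] f) := by
    intro f
    rcases w with _ | ⟨_ | c, w⟩
    · exact exec_popInp_nil t
    · exact exec_popInp_cons t
    · simp at hw
  have key := Machine.runs_whileDo_list (q := popInp t) (test := isCell)
    (P := .seq (.basic (pushBuf .left)) (.seq (readCells t)
      (.basic (.push (.work (.down 3)) (fun _ => none) (pushSep .left)))))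
    (fun (l : List (Fin (m + 1) → Bool)) (c : List Sym × ℕ) => ((true, none), stk
      (l.flatMap (fun f => (List.ofFn fun v => some (f v)) ++ [none]) ++ w) []
        (reading c.1 [] x a c.2 y)))
    (fun c f => (((List.ofFn fun v => some (bitCell t (f v))) ++ [none]).reverse ++ c.1, c.2 + 1))
    (2 * m + 3) ?_ ?_ l (left, r)
  · refine key.congr rfl ?_ le_rfl
    have : ∀ (l : List (Fin (m + 1) → Bool)) (c : List Sym × ℕ), l.foldl (fun c f =>
        (((List.ofFn fun v => some (bitCell t (f v))) ++ [none]).reverse ++ c.1, c.2 + 1)) c =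
        ((l.flatMap fun f => (List.ofFn fun v => some (bitCell t (f v))) ++ [none]).reverse ++ c.1,
          c.2 + l.length) := by
      intro l
      induction l with
      | nil => simp
      | cons b l ih =>
        intro c
        rw [List.foldl_cons, ih, List.flatMap_cons]
        simp only [List.reverse_append, List.append_assoc, List.length_cons, Nat.add_assoc,
          Nat.add_comm 1]
    rw [this, List.flatMap_nil, List.nil_append, hexec]
  · intro f l c
    rw [List.flatMap_cons, List.ofFn_succ, List.cons_append, List.cons_append, List.cons_append,
      exec_popInp_cons]
    refine ⟨rfl, ?_⟩
    have h1 := Machine.runs_basic (pushBuf .left) ((true, some (some (bitCell t (f 0)))),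
      stk ((List.ofFn fun v : Fin m => some (f v.succ)) ++ [none] ++
        l.flatMap (fun f => (List.ofFn fun v => some (f v)) ++ [none]) ++ w) []
        (reading c.1 [] x a c.2 y))
    rw [exec_pushBuf] at h1
    have h2 := runs_readCells t (List.ofFn fun v : Fin m => f v.succ)
      (l.flatMap (fun f => (List.ofFn fun v => some (f v)) ++ [none]) ++ w)
      (some (bitCell t (f 0)) :: c.1) x a c.2 y
    have h3 := Machine.runs_basic
      (.push (.work (.down 3)) (fun _ => none) (pushSep .left) : Line) ((true, some none),
        stk (l.flatMap (fun f => (List.ofFn fun v => some (f v)) ++ [none]) ++ w) []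
          (reading (((List.ofFn fun v : Fin m => f v.succ).map
            fun b => some (bitCell t b)).reverse ++ (some (bitCell t (f 0)) :: c.1)) [] x a c.2 y))
    refine (h1.seq ((h2.congr ?_ rfl le_rfl).seq h3)).congr ?_ ?_ ?_
    · simp [reading, List.map_ofFn, Function.comp_def]
    · rfl
    · simp only [Machine.exec, pushSep, reading, stepAux, stk_work, update_stk_work, work_down,
        update_work_down, work_left, update_work_left]
      congr 2
      congr 1
      · simp [List.map_ofFn, Function.comp_def]
      · funext i
        fin_cases i <;> rfl
    · simp
      omega
  · intro c
    rw [List.flatMap_nil, List.nil_append, hexec]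
    cases w.head? <;> rfl

/-- Reset the finite control. -/
def reset : Line :=
  .load (fun _ => (true, none)) .halt

/-- Read the whole input. -/
def readInput : Prog :=
  .seq readLength <| .seq (.basic reset) <| .seq readPosition <| .seq (.basic reset) <|
    .seq (readRows 0) <| .seq (.basic reset) <| .seq (readRows 2) (transfer .left .right)

theorem runs_reset (v : Control) (w : List (Option Bool)) (o : List Bool) (f : Work → List Sym) :
    (Machine.basic reset).Runs 1 (v, stk w o f) ((true, none), stk w o f) := by
  refine (Machine.runs_basic reset _).congr rfl ?_ le_rfl
  simp [Machine.exec, reset]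

theorem rows_eq_flatMap (M : Mem) (n s : ℕ) {l : ℕ} (g : Fin l → Fin n → Cell)
    (hg : ∀ (i : Fin l) (j : Fin n), M (s + i) j = g i j) : rows M n s l =
      (List.ofFn g).flatMap fun f => (List.ofFn fun v => some (f v)) ++ [none] := by
  induction l generalizing s with
  | zero => simp [rows]
  | succ l ih =>
    rw [rows_succ, List.ofFn_succ, List.flatMap_cons,
      ih (s + 1) (fun i => g i.succ) fun i j => by
        rw [← hg, Fin.val_succ]; congr 1; omega]
    have : (cells M s 0 n).map some = List.ofFn fun v => some (g 0 v) := by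
      refine List.ext_getElem (by simp) fun j h1 h2 => ?_
      have h3 : j < n := by simpa using h1
      have := hg 0 ⟨j, h3⟩
      simpa [cells] using this
    rw [this]
    simp

open Classical in
/-- The initial contents of the memory. -/
noncomputable def inputMem (I : GenReachInput) : Mem := fun i j t =>
  if h : i < I.n ∧ j < I.n then decide (I.arena.edge ⟨i, h.1⟩ ⟨j, h.2⟩) && t == 0
  else if h : i - I.n < I.k ∧ j < I.n then decide ((⟨j, h.2⟩ : Fin I.n) ∈ I.target ⟨i - I.n, h.1⟩) && t == 2
  else false

open Classical in
theorem inputMem_edge (I : GenReachInput) (u v : Fin I.n) :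
    inputMem I u v = bitCell 0 (decide (I.arena.edge u v)) := by
  funext t
  simp [inputMem, bitCell]

open Classical in
theorem inputMem_target (I : GenReachInput) (i : Fin I.k) (v : Fin I.n) :
    inputMem I (I.n + i) v = bitCell 2 (decide (v ∈ I.target i)) := by
  funext t
  simp [inputMem, bitCell]

theorem length_encode (I : GenReachInput) :
    I.encode.length = 2 * (I.n + 1) + I.n * (I.n + 1) + 1 + I.k * (I.n + 1) := by
  simp only [GenReachInput.encode, List.length_append, GenReachInput.length_flatten_encodeSet,
    GenReachInput.encodeSet_length, List.length_singleton]
  ring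

/-- Turns bounds in the number of rows into bounds in the length of the input. -/
theorem size_le_length_encode (I : GenReachInput) : I.n + I.k ≤ I.encode.length := by
  rw [length_encode]
  nlinarith

theorem runs_readInput (I : GenReachInput) :
    readInput.Runs (20 * (I.encode.length + 1) ^ 2)
      ((true, none), stk I.encode [] fun _ => [])
      (rep I.n (I.n + I.k) ![0, 0, 0, 0, I.start, 0] true (inputMem I)) := by
  classical
  obtain ⟨n, A, k, F, s⟩ := I
  -- The starting vertex shows that there is at least one vertex.
  obtain ⟨m, rfl⟩ : ∃ m, n = m + 1 := ⟨n - 1, by have := s.2; omega⟩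
  set I : GenReachInput := ⟨m + 1, A, k, F, s⟩ with hI
  let ve : List Bool := List.ofFn fun v => decide (v ∈ A.eve)
  let vs : List Bool := List.ofFn fun v => decide (v = s)
  let lE : List (Fin (m + 1) → Bool) := List.ofFn fun u v => decide (A.edge u v)
  let lF : List (Fin (m + 1) → Bool) := List.ofFn fun i v => decide (v ∈ F i)
  let enc : (Fin (m + 1) → Bool) → List (Option Bool) := fun f =>
    (List.ofFn fun v => some (f v)) ++ [none]
  have hw : I.encode = ve.map some ++ none :: (vs.map some ++ none ::
      (lE.flatMap enc ++ none :: (lF.flatMap enc ++ []))) := by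
    change GenReachInput.encode ⟨m + 1, A, k, F, s⟩ = _
    simp only [GenReachInput.encode, GenReachInput.encodeSet, ve, vs, lE, lF, enc,
      List.map_ofFn, Function.comp_def, Set.mem_singleton_iff, Set.mem_ofPred_eq,
      List.flatMap_def, List.append_assoc, List.append_nil, List.nil_append, List.cons_append]
  have h1 := runs_readLength ve (vs.map some ++ none ::
      (lE.flatMap enc ++ none :: (lF.flatMap enc ++ [])))
  have h2 := runs_readPosition vs (lE.flatMap enc ++ none :: (lF.flatMap enc ++ [])) ve.length
  have h3 := runs_readRows 0 lE (none :: (lF.flatMap enc ++ [])) rfl []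
    (vs.foldl countStep (true, 0, 0)).2.1 ve.length 0 (vs.foldl countStep (true, 0, 0)).2.2
  have h4 := runs_readRows 2 lF [] rfl ((lE.flatMap fun f =>
    (List.ofFn fun v => some (bitCell 0 (f v))) ++ [none]).reverse ++ [])
    (vs.foldl countStep (true, 0, 0)).2.1 ve.length (0 + lE.length)
    (vs.foldl countStep (true, 0, 0)).2.2
  -- The rows lie reversed on `left`; one transfer puts the head at the beginning of the memory.
  have h5 := runs_rewind (a := true) (w := []) (o := []) (left :=
      (lF.flatMap fun f => (List.ofFn fun v => some (bitCell 2 (f v))) ++ [none]).reverse ++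
      ((lE.flatMap fun f => (List.ofFn fun v => some (bitCell 0 (f v))) ++ [none]).reverse ++ []))
    (right := []) (up := ![[], [], [], [], unary (vs.foldl countStep (true, 0, 0)).2.1, []])
    (down := ![unary ve.length, unary ve.length, unary ve.length,
      unary (0 + lE.length + lF.length), unary (vs.foldl countStep (true, 0, 0)).2.2,
      unary ve.length])
  refine (h1.seq ((runs_reset _ _ _ _).seq (h2.seq ((runs_reset _ _ _ _).seq (h3.seq
    ((runs_reset _ _ _ _).seq (h4.seq h5))))))).congr ?_ ?_ ?_
  · rw [hw]
    congr 2
    funext k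
    cases k with
    | up i => simp only [reading, work_up]; fin_cases i <;> rfl
    | down i => simp only [reading, work_down]; fin_cases i <;> rfl
    | _ => rfl
  · have hs : vs.foldl countStep (true, 0, 0) = (false, (s : ℕ), m + 1 - s) := foldl_countStep s
    have hrows : rows (inputMem I) (m + 1) 0 (m + 1 + k) =
        (lE.flatMap fun f => (List.ofFn fun v => some (bitCell 0 (f v))) ++ [none]) ++
        (lF.flatMap fun f => (List.ofFn fun v => some (bitCell 2 (f v))) ++ [none]) := by
      rw [rows_add]
      congr 1
      · rw [rows_eq_flatMap (g := fun u v => bitCell 0 (decide (A.edge u v)))]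
        · simp [lE, List.flatMap_def, List.map_ofFn, Function.comp_def]
        · intro i j
          rw [Nat.zero_add]
          exact inputMem_edge I i j
      · rw [rows_eq_flatMap (g := fun u v => bitCell 2 (decide (v ∈ F u)))]
        · simp [lF, List.flatMap_def, List.map_ofFn, Function.comp_def]
        · intro i j
          rw [Nat.zero_add]
          exact inputMem_target I i j
    rw [rep]
    change _ = ((true, none), stk [] [] (work [] [] (rows (inputMem I) (m + 1) 0 (m + 1 + k)) _ _))
    rw [hrows]
    congr 2
    rw [hs]
    congr 1
    · simp
    · funext i
      fin_cases i <;> rfl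
    · funext i
      fin_cases i <;> simp [downs, bound, rowReg, ve, lE, lF, hI]
      rfl
  · have hl := length_encode I
    have e1 : I.n = m + 1 := rfl
    have e2 : I.k = k := rfl
    rw [e1, e2] at hl
    have l1 : ve.length = m + 1 := by simp [ve]
    have l2 : vs.length = m + 1 := by simp [vs]
    have l3 : lE.length = m + 1 := by simp [lE]
    have l4 : lF.length = k := by simp [lF]
    have l5 : ∀ (l : List (Fin (m + 1) → Bool)) (t : Fin 9), (l.flatMap fun f =>
        (List.ofFn fun v => some (bitCell t (f v))) ++ [(none : Sym)]).length =
          l.length * (m + 2) := by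
      intro l t
      simp [List.length_flatMap]
    simp only [List.length_append, List.length_reverse, List.length_nil, l5, l1, l2, l3, l4]
    generalize I.encode.length = L at *
    nlinarith

/-! ### Writing the output -/

/-- Clear a stack. -/
def clear (s : Work) : Prog :=
  .whileDo (popBuf s .halt) (fun v => v.2.isSome) (.basic clearBuf)

theorem runs_clear (s : Work) (a : Bool) (w : List (Option Bool)) (o : List Bool)
    (f : Work → List Sym) : (clear s).Runs ((f s).length * 2 + 1)
      ((a, none), stk w o f) ((a, none), stk w o (Function.update f s [])) := by
  have key := Machine.runs_whileDo_list (q := popBuf s .halt)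
    (test := fun v : Control => v.2.isSome) (P := .basic clearBuf)
    (fun (l : List Sym) (_ : Unit) => ((a, none), stk w o (Function.update f s l)))
    (fun _ _ => ()) 1 ?_ ?_ (f s) ()
  · refine key.congr (by simp) ?_ le_rfl
    simp [exec_popBuf]
  · intro x l _
    rw [exec_popBuf]
    refine ⟨by simp, (Machine.runs_basic _ _).congr rfl ?_ le_rfl⟩
    simp [Machine.exec, clearBuf]
  · intro _
    simp [exec_popBuf]

/-- Needed because the machine must halt with every stack but the output empty. -/
theorem exists_runs_clear (l : List Work) : ∃ P : Prog, ∀ (a : Bool) (w : List (Option Bool))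
    (o : List Bool) (f : Work → List Sym) (B : ℕ), (∀ s, (f s).length ≤ B) →
      P.Runs (l.length * (B * 2 + 1) + 1) ((a, none), stk w o f)
        ((a, none), stk w o fun s => if s ∈ l then [] else f s) := by
  induction l with
  | nil =>
    refine ⟨.basic clearBuf, fun a w o f B _ => ?_⟩
    refine (Machine.runs_basic _ _).congr rfl ?_ (by simp)
    simp [Machine.exec, clearBuf]
  | cons s l ih =>
    obtain ⟨P, hP⟩ := ih
    refine ⟨.seq (clear s) P, fun a w o f B hB => ?_⟩
    refine ((runs_clear s a w o f).seq (hP a w o (Function.update f s []) B fun s' => ?_)).congr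
      rfl ?_ ?_
    · rw [Function.update_apply]
      split_ifs
      · simp
      · exact hB s'
    · congr 2
      funext s'
      by_cases h : s' = s <;> simp [h]
    · have := hB s
      rw [List.length_cons, Nat.add_mul]
      omega

/-- Write the flag to the output. -/
def writeFlag : Line :=
  .push .out (fun v => v.1) reset

/-- The failure bit sits in cell `(0, 0)`, addressed through register `5`. The control also returns
to its initial state, as halting configurations require. -/
theorem exists_runs_output : ∃ (P : Prog) (p : Polynomial ℕ), ∀ (m n N : ℕ) (e : Env) (M : Mem),
    n ≤ N → N ≤ m → (∀ i, e i < bound n N i) → e 5 = 0 →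
      P.Runs (p.eval m) (rep n N e true M)
        ((true, none), stk [] [!(M 0 0 8)] fun _ => []) := by
  obtain ⟨P, hP⟩ := exists_runs_clear Finset.univ.toList
  refine ⟨.seq (access 5 5 fun c _ => (c, !(c 8))) (.seq (.basic writeFlag) P),
    accessCost + (1 + (.C (Finset.univ : Finset Work).toList.length *
      ((Polynomial.X + 1) * (Polynomial.X + 1) * 2 + 1) + 1)), fun m n N e M h1 h2 h3 h4 => ?_⟩
  obtain ⟨h5, h6⟩ := access_bounds h1 h3 5 (j := 5) (by decide)
  have h7 := runs_access 5 5 (fun c _ => (c, !(c 8))) (a := true) (M := M) h5 h6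
  rw [setCell_self] at h7
  have h8 := Machine.runs_basic writeFlag (rep n N e (!(M (e 5) (e 5) 8)) M)
  -- A common bound for all stacks; the memory, of length `N * (n + 1)`, and the registers all fit.
  have h9 := hP true [] [!(M 0 0 8)] (work [] [] (rows M n 0 N) (ups e) (downs n N e))
    ((m + 1) * (m + 1)) ?_
  · refine ((h7.mono (le_accessCost h1 h2)).seq ((h8.congr rfl ?_ le_rfl).seq h9)).congr rfl ?_ ?_
    · simp [Machine.exec, writeFlag, reset, rep, h4]
    · simp
    · simp only [Polynomial.eval_add, Polynomial.eval_mul, Polynomial.eval_X,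
        Polynomial.eval_one, Polynomial.eval_C, Polynomial.eval_ofNat]
      exact le_rfl
  · have hb : ∀ i, bound n N i ≤ m := fun i => by unfold bound; split_ifs <;> omega
    have hm : m ≤ (m + 1) * (m + 1) := by nlinarith
    intro s
    cases s with
    | right =>
      rw [work_right, length_rows]
      gcongr <;> omega
    | up i =>
      have := h3 i
      have := hb i
      simp only [work_up, ups, length_unary]
      omega
    | down i =>
      have := hb i
      simp only [work_down, downs, length_unary]
      omega
    | _ => simp

open Classical in
/-- There is a program that decides one-player generalized reachability games whose reachability
sets have two elements. -/
theorem exists_runs_decide : ∃ (P : Prog) (p : Polynomial ℕ), ∀ I : GenReachInput,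
    I.arena.IsOnePlayer → (∀ i, (I.target i).ncard = 2) →
      P.Runs (p.eval I.encode.length) ((true, none), stk I.encode [] fun _ => [])
        ((true, none), stk [] [decide I.EveWins] fun _ => []) := by
  obtain ⟨P, p, hP⟩ := realizable_solve
  obtain ⟨Q, q, hQ⟩ := exists_runs_output
  refine ⟨.seq readInput (.seq P Q), 20 * (Polynomial.X + 1) ^ 2 + (p + q), fun I h1 h2 => ?_⟩
  have hn : I.n ≤ I.n + I.k := Nat.le_add_right _ _
  have hN := size_le_length_encode I
  have hs : (I.start : ℕ) < I.n := I.start.2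
  have he : ∀ i, (![0, 0, 0, 0, I.start, 0] : Env) i < bound I.n (I.n + I.k) i := by
    intro i
    fin_cases i <;> simp [bound, rowReg] <;> omega
  have h3 := hP _ _ _ ![0, 0, 0, 0, I.start, 0] (inputMem I) hn hN he (by simp)
  have h4 := hQ _ _ _ ![0, 0, 0, 0, I.start, 0]
    (solve I.n (I.n + I.k) ![0, 0, 0, 0, I.start, 0] (inputMem I)) hn hN he rfl
  refine ((runs_readInput I).seq (h3.seq h4)).congr rfl ?_ (by simp)
  have key := solve_apply h2 (s := I.start) (N := I.n + I.k) (M := inputMem I) ?_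
    (A := I.arena) ?_ ?_
  · rw [← h1.eveWins_genReach_iff] at key
    congr 3
    rw [Bool.eq_iff_iff, decide_eq_true_iff, Bool.not_eq_true', key]
    rfl
  · intro a b t h0 h2
    unfold inputMem
    split_ifs <;> simp [h0, h2]
  · intro u v
    rw [inputMem_edge]
    simp [bitCell]
  · intro r v
    constructor
    · rintro ⟨hr, h⟩
      by_cases hrn : r < I.n
      · rw [inputMem_edge I ⟨r, hrn⟩ v] at h
        simp [bitCell] at h
      · obtain ⟨i, rfl⟩ : ∃ i, r = I.n + i := ⟨r - I.n, by omega⟩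
        rw [inputMem_target I ⟨i, by omega⟩ v] at h
        exact ⟨⟨i, by omega⟩, rfl, by simpa [bitCell] using h⟩
    · rintro ⟨i, rfl, h⟩
      refine ⟨by omega, ?_⟩
      rw [inputMem_target]
      simpa [bitCell] using h

end GridMachine

/-! ### The main theorem -/

theorem mainTheorem7 :
    SolvableInPolyTime
      (fun I : {I : GenReachInput // I.arena.IsOnePlayer ∧ ∀ i, (I.target i).ncard = 2} =>
        I.1.encode)
      (fun I => I.1.EveWins) ∧
    ∀ (V : Type*) [Finite V] (A : Arena V) (_ : A.IsOnePlayer) (k : ℕ) (x y : Fin k → V)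
      (_ : ∀ i, x i ≠ y i) (v₀ : V),
      A.EveWins (A.genReach fun i => {x i, y i}) v₀ ↔ (A.formula x y v₀).Satisfiable := by
  constructor
  · obtain ⟨P, p, hP⟩ := GridMachine.exists_runs_decide
    have h := fun I : {I : GenReachInput // I.arena.IsOnePlayer ∧ ∀ i, (I.target i).ncard = 2} =>
      hP I.1 I.2.1 I.2.2
    choose t ht hr using h
    have := P.fin
    refine ⟨⟨⟨{
      k₀ := GridMachine.Stack.inp
      k₁ := GridMachine.Stack.out
      Γ := GridMachine.Gam
      Λ := P.Λ
      main := P.entry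
      σ := GridMachine.Control
      initialState := (true, none)
      Γk₀Fin := inferInstanceAs (Fintype (Option Bool))
      m := P.m }, Equiv.refl _, Equiv.refl _⟩, p, fun I => ⟨⟨t I, ?_⟩, ht I⟩⟩⟩
    -- The run already has the right steps; its end configurations remain to be matched stack by
    -- stack with the prescribed initial and halting ones.
    refine Eq.trans (congrArg _ (congrArg some ?_)) ((hr I).iterate.trans (congrArg some ?_))
    · unfold initList
      congr 1
      funext k
      rcases k with _ | _ | s
      · exact List.map_id _
      · rfl
      · rfl
    · unfold haltList
      congr 1
      funext k
      rcases k with _ | _ | s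
      · rfl
      · exact (List.map_id _).symm
      · rfl
  · intro V _ A hA k x y _ v₀
    -- Both sides amount to a conflict-free set meeting every color.
    rw [hA.eveWins_genReach_iff, A.formula_satisfiable_iff]
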